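/- **Setting.** Fix one degree of homology, so that a feature is a point $(b,d)$ of the wedge $W=\{(b,d)\in\mathbb R^2: d>b\ge 0\}$, with interior $W^\circ=\{d>b>0\}$; put $T=\{d>b\}\subset\mathbb R^2$. A global pdf is a function $f$ on $\bigsqcup_{N\ge 0}W^N$ whose local densities $f_N=f|_{W^N}$ are measurable and nonnegative and satisfy $\sum_{N}\int_{W^N}f_N=1$. A random vector of features $\mathscr D\in\bigsqcup_N W^N$, which represents the random persistence diagram $\{\xi_1,\dots,\xi_N\}$, is distributed according to $f$ if $P(\mathscr D\in A)=\int_A f_N$ for every $N$ and every Borel set $A\subseteq W^N$. **Kernel.** Let $\sigma>0$ and let $\mathscr D=(\eta_1,\dots,\eta_m)$ be a center, $\eta_i=(b_i,d_i)$. Its upper features are those with $d_i-b_i\ge\sigma$; write them, in the order in which they occur in $\mathscr D$, as $\eta^{(1)},\dots,\eta^{(N_u)}$. Its lower features are those with $d_i-b_i<\sigma$; let $N_\ell$ be their number. Let $\varphi_j$ be the density of the planar normal law with mean $\eta^{(j)}$ and covariance $\sigma^2 I$, and put $$q^{(j)}=\int_T\varphi_j,\qquad p^{(j)}(\xi)=\frac{\varphi_j(\xi)}{\int_W\varphi_j}\mathbf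 1_W(\xi),\qquad p^\ell(b,d)=\frac1{N_\ell}\sum_{i\ \text{lower}}\frac1{\pi\sigma^2}\exp\Bigl(-\tfrac{(b-\frac{b_i+d_i}2)^2+(d-\frac{b_i+d_i}2)^2}{2\sigma^2}\Bigr)$$ (with $p^\ell=0$ if $N_\ell=0$). For $\gamma$ in the set $I(j,N_u)$ of increasing injections $\{1,\dots,j\}\to\{1,\dots,N_u\}$ let $$\mathcal Q(\gamma)=\frac{\prod_{i=1}^{N_u}(1-q^{(i)})}{\prod_{k=1}^{j}(1-q^{(\gamma(k))})}\prod_{k=1}^j q^{(\gamma(k))}.$$ Fix a family $(\nu_\ell)_{\ell\ge 0}$ of probability mass functions on $\{0,1,2,\dots\}$ such that $\nu_\ell$ has mean $\ell$ and, for some constant $c>0$ independent of $\ell$, $\nu_\ell(k)=0$ whenever $k>c\,\ell$; put $\nu_\ell(k)=0$ for $k<0$. For $Z=(\xi_1,\dots,\xi_N)$ define $$K_\sigma(Z,\mathscr D)=\sum_{j=0}^{N_u}\nu_{N_\ell}(N-j)\sum_{\gamma\in I(j,N_u)}\mathcal Q(\gamma)\prod_{k=1}^{j}p^{(\gamma(k))}(\xi_k)\prod_{k=j+1}^{N}p^\ell(\xi_k).$$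 **Theorem (KDE convergence).** Let $M\in\mathbb N$ and let $f$ be a global pdf whose local densities $f_N$ are continuous on $(W^\circ)^N$ and such that - (A1) $f_N=0$ for $N>M$; - (A2) $f_N$ is bounded on $W^N$ for $1\le N\le M$; - (A3) for $1\le N\le M$ there is $C_N>0$ with $f_N(\xi_1,\dots,\xi_N)\le C_N\|(\xi_1,\dots,\xi_N)\|^{-2N}$ on $W^N$, where $\|\cdot\|$ is the Euclidean norm. Let $\mathscr D_1,\mathscr D_2,\dots$ be i.i.d. and distributed according to $f$. Let $\sigma_n>0$ be bandwidths of exact order $n^{-\alpha}$ (that is, $c_1n^{-\alpha}\le\sigma_n\le c_2n^{-\alpha}$ for all large $n$, with constants $c_1,c_2>0$), where $0<\alpha<\alpha_{2M}:=\frac1{2M}$ (any $\alpha>0$ if $M=0$), and let $\hat f_n(Z)=\frac1n\sum_{i=1}^nK_{\sigma_n}(Z,\mathscr D_i)$. Then, almost surely, $\hat f_n\to f$ as $n\to\infty$, uniformly on every compact subset of $\bigsqcup_{N\ge0}(W^\circ)^N$. -/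

import Mathlib

open MeasureTheory ProbabilityTheory Filter Topology Asymptotics

noncomputable section

namespace PersistenceKDE

/-- A feature of a persistence diagram (in one fixed degree of homology) is a pair `(birth, death)`
in the plane, which carries Lebesgue measure. -/
abbrev Feature : Type := ℝ × ℝ

/-- The infinite wedge `W = {(b, d) : d > b ≥ 0}`. -/
def wedge : Set Feature := {x | 0 ≤ x.1 ∧ x.1 < x.2}

/-- The interior `{(b, d) : d > b > 0}` of the wedge. -/
def openWedge : Set Feature := {x | 0 < x.1 ∧ x.1 < x.2}

/-- The half plane `T = {(b, d) : d > b}` above the diagonal. -/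
def halfPlane : Set Feature := {x | x.1 < x.2}

/-- The power `A ^ N`, as a set of vectors of `N` features. -/
def power (A : Set Feature) (N : ℕ) : Set (Fin N → Feature) := {ξ | ∀ i, ξ i ∈ A}

/-- Finite vectors of features of arbitrary length: the disjoint union over `N` of the spaces of
vectors of `N` features, with the disjoint union topology and σ-algebra. The vector
`(ξ₁, …, ξ_N)` represents the persistence diagram (multiset) `{ξ₁, …, ξ_N}`. -/
abbrev Diagram : Type := Σ N : ℕ, (Fin N → Feature)

/-! ### Global densities -/

/-- The measure on vectors of features whose restriction to the vectors of length `N` has density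
`f N` with respect to Lebesgue measure on `W ^ N`. -/
def diagramLaw (f : (N : ℕ) → (Fin N → Feature) → ℝ) : Measure Diagram :=
  Measure.sum fun N : ℕ =>
    ((volume.restrict (power wedge N)).withDensity fun ξ => ENNReal.ofReal (f N ξ)).map
      (Sigma.mk N)

/-- `f` is a global probability density function for random persistence diagrams in the wedge: its
layers `f N`, the local densities on `W ^ N`, are measurable and nonnegative, and their integrals
(the probabilities of the cardinalities `N`) add up to one. The values of `f N` outside `W ^ N`
are irrelevant. -/
structure IsGlobalPdf (f : (N : ℕ) → (Fin N → Feature) → ℝ) : Prop where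
  aemeasurable : ∀ N, AEMeasurable (f N) (volume.restrict (power wedge N))
  nonneg : ∀ N, ∀ ξ ∈ power wedge N, 0 ≤ f N ξ
  total : ∑' N : ℕ, ∫⁻ ξ in power wedge N, ENNReal.ofReal (f N ξ) = 1

/-- The belief function of the random diagram distributed according to `f`: the probability that all
features lie in the Borel set `A ⊆ W` is the sum over `N` of the integrals of `f N` over `A ^ N`. -/
theorem diagramLaw_belief (f : (N : ℕ) → (Fin N → Feature) → ℝ) {A : Set Feature}
    (hA : MeasurableSet A) (hAW : A ⊆ wedge) :
    diagramLaw f {Z | Z.2 ∈ power A Z.1} =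
      ∑' N : ℕ, ∫⁻ ξ in power A N, ENNReal.ofReal (f N ξ) := by
  have hp : ∀ N, MeasurableSet (power A N) := fun N => by
    have h : power A N = Set.pi Set.univ fun _ => A := by ext; simp [power]
    rw [h]
    exact MeasurableSet.univ_pi fun _ => hA
  have hm : ∀ N, Measurable (@Sigma.mk ℕ (fun N => Fin N → Feature) N) := fun N _ hs =>
    MeasurableSpace.measurableSet_iInf.1 hs N
  have hS : MeasurableSet {Z : Diagram | Z.2 ∈ power A Z.1} :=
    MeasurableSpace.measurableSet_iInf.2 hp
  have hpre : ∀ N, (@Sigma.mk ℕ (fun N => Fin N → Feature) N) ⁻¹' {Z | Z.2 ∈ power A Z.1} =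
      power A N := fun N => rfl
  have hinter : ∀ N, power A N ∩ power wedge N = power A N := fun N =>
    Set.inter_eq_left.2 fun ξ h i => hAW (h i)
  rw [diagramLaw, Measure.sum_apply _ hS]
  refine tsum_congr fun N => ?_
  rw [Measure.map_apply (hm N) hS, hpre, withDensity_apply _ (hp N),
    Measure.restrict_restrict (hp N), hinter]

/-- (A1) bounded cardinality: `f` vanishes on diagrams with more than `M` features. -/
def BoundedCardinality (f : (N : ℕ) → (Fin N → Feature) → ℝ) (M : ℕ) : Prop :=
  ∀ N, M < N → ∀ ξ ∈ power wedge N, f N ξ = 0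

/-- (A2) the local densities are bounded. -/
def BoundedLocalDensities (f : (N : ℕ) → (Fin N → Feature) → ℝ) (M : ℕ) : Prop :=
  ∀ N, 1 ≤ N → N ≤ M → ∃ C : ℝ, ∀ ξ ∈ power wedge N, f N ξ ≤ C

/-- (A3) polynomial decay: `f N ξ ≤ C_N ‖ξ‖ ^ (-2 N)`, where `‖ξ‖` is the Euclidean norm on
`ℝ ^ (2 N)`; the denominator below is `(‖ξ‖ ^ 2) ^ N`. -/
def PolynomialDecay (f : (N : ℕ) → (Fin N → Feature) → ℝ) (M : ℕ) : Prop :=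
  ∀ N, 1 ≤ N → N ≤ M → ∃ C : ℝ, 0 < C ∧ ∀ ξ ∈ power wedge N,
    f N ξ ≤ C / (∑ i, ((ξ i).1 ^ 2 + (ξ i).2 ^ 2)) ^ N

/-! ### The kernel density -/

/-- The density at `x` of the planar normal distribution with mean `c` and standard deviation `σ`
in each coordinate. -/
def gauss (σ : ℝ) (c x : Feature) : ℝ :=
  1 / (2 * Real.pi * σ ^ 2) *
    Real.exp (-((x.1 - c.1) ^ 2 + (x.2 - c.2) ^ 2) / (2 * σ ^ 2))

/-- The probability that the singleton diagram centered at `c` is nonempty: the Gaussian mass of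
the half plane above the diagonal. -/
def presence (σ : ℝ) (c : Feature) : ℝ := ∫ x in halfPlane, gauss σ c x

open Classical in
/-- The modified Gaussian density: the Gaussian restricted to the wedge and renormalized. -/
def upperDensity (σ : ℝ) (c x : Feature) : ℝ :=
  if x ∈ wedge then gauss σ c x / ∫ y in wedge, gauss σ c y else 0

/-- Indices of the upper features `d - b ≥ σ` of the center `η`, in the order inherited from `η`. -/
abbrev Upper (σ : ℝ) {m : ℕ} (η : Fin m → Feature) : Type :=
  {i : Fin m // σ ≤ (η i).2 - (η i).1}

/-- Indices of the lower features `d - b < σ` of the center `η`. -/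
abbrev Lower (σ : ℝ) {m : ℕ} (η : Fin m → Feature) : Type :=
  {i : Fin m // (η i).2 - (η i).1 < σ}

open Classical in
/-- The number `N_u` of upper features. -/
def numUpper (σ : ℝ) {m : ℕ} (η : Fin m → Feature) : ℕ := Fintype.card (Upper σ η)

open Classical in
/-- The number `N_ℓ` of lower features. -/
def numLower (σ : ℝ) {m : ℕ} (η : Fin m → Feature) : ℕ := Fintype.card (Lower σ η)

open Classical in
/-- The lower density: the lower features are projected to the diagonal, and each of them carries a
Gaussian restricted to the half plane above the diagonal (whence the constant `1 / (π σ²)`). -/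
def lowerDensity (σ : ℝ) {m : ℕ} (η : Fin m → Feature) (x : Feature) : ℝ :=
  1 / (numLower σ η : ℝ) * ∑ i : Lower σ η,
    1 / (Real.pi * σ ^ 2) *
      Real.exp (-((x.1 - ((η i).1 + (η i).2) / 2) ^ 2 + (x.2 - ((η i).1 + (η i).2) / 2) ^ 2)
        / (2 * σ ^ 2))

open Classical in
/-- The weight `Q(γ) = Q*(γ) ∏ q^{(γ(k))}` with
`Q*(γ) = ∏_j (1 - q^{(j)}) / ∏_k (1 - q^{(γ(k))})`. -/
def weight (σ : ℝ) {m : ℕ} (η : Fin m → Feature) {j : ℕ} (γ : Fin j → Upper σ η) : ℝ :=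
  (∏ i : Upper σ η, (1 - presence σ (η i))) / (∏ k, (1 - presence σ (η (γ k)))) *
    ∏ k, presence σ (η (γ k))

/-- Admissible cardinality laws of the lower random diagram: for `ℓ` lower features, `ν ℓ` is a
probability mass function with mean `ℓ` that vanishes beyond `m * ℓ`, with `m` independent
of `ℓ`. -/
def IsLowerCardinality (ν : ℕ → PMF ℕ) : Prop :=
  (∀ ℓ : ℕ, HasSum (fun k : ℕ => (k : ℝ) * (ν ℓ k).toReal) (ℓ : ℝ)) ∧
    ∃ m : ℝ, 0 < m ∧ ∀ ℓ k : ℕ, m * ℓ < k → ν ℓ k = 0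

open Classical in
/-- The kernel density `K_σ(Z, D)` at the input `Z = (ξ₁, …, ξ_N)`. The number `j` of inputs that are
assigned to upper features runs from `0` to `N_u`; terms with `j > N` are absent since `ν` lives on
nonnegative integers. The assignments `γ` are the increasing injections of `{1, …, j}` into the
upper features. -/
def kernel (ν : ℕ → PMF ℕ) (σ : ℝ) (Z D : Diagram) : ℝ :=
  ∑ j ∈ Finset.range (numUpper σ D.2 + 1),
    if h : j ≤ Z.1 then
      (ν (numLower σ D.2) (Z.1 - j)).toReal *
        ∑ γ ∈ Finset.univ.filter (fun γ : Fin j → Upper σ D.2 => StrictMono γ),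
          weight σ D.2 γ *
            (∏ k : Fin j, upperDensity σ (D.2 (γ k)) (Z.2 (Fin.castLE h k))) *
            ∏ k ∈ Finset.univ.filter (fun k : Fin Z.1 => j ≤ (k : ℕ)),
              lowerDensity σ D.2 (Z.2 k)
    else 0

/-- The kernel density estimate with bandwidth `σ` and centers `D 0, …, D (n - 1)`. -/
def kde (ν : ℕ → PMF ℕ) (σ : ℝ) (D : ℕ → Diagram) (n : ℕ) (Z : Diagram) : ℝ :=
  1 / (n : ℝ) * ∑ i ∈ Finset.range n, kernel ν σ Z (D i)

end PersistenceKDE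

end

noncomputable section

namespace PersistenceKDE

/-! ### The planar Gaussian -/

/-! Split the kernel at an input of length N by the number j of inputs assigned to upper features.
On a compact subset of (W°)^N every input has gap d - b at least some δ > 0, and there the lower
density is O(σ⁻² exp(-δ²/(4σ²))). Hence the terms with j < N are negligible uniformly in the center
(`abs_kernel_sub_upperPart_le`, `tendsto_lowerError`). The term j = N is `upperPart`: a sum over
increasing choices of N upper features of products of N Gaussians, with a factor 1 - q for each
upper feature that is not chosen.

Bias: sort the expectation of `upperPart` by the number m of features of the center. Layers m < N
contribute nothing. On the layer m = N only the identity assignment exists, and the result is a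
Gaussian smoothing of f_N with amplitudes tending to 1; it converges to f_N locally uniformly
(`tendsto_layerMean_self`). For m > N each of the m - N features that are not hit has to be close to
the diagonal, since 1 - q = O(σ²/(d - b)²), and after integration it costs a factor O(σ). The
integral along the diagonal converges because (A2) and (A3) together give f_m ≤ C ∏ (1 + b_i²)⁻¹
(`exists_le_mul_prod`). So these layers are O(σ^(m-N)) (`layerMean_le`).

Fluctuation: `upperPart` lies in [0, B] with B of order σ^(-2N), and its mean is bounded, so its
second moment is O(B). A Bernstein bound then gives tails exp(-c n/B), at most exp(-c' n^(1-2Nα)),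
with a positive exponent because N ≤ M and 2Mα < 1. `upperPart` is Lipschitz in the input with a
constant polynomial in n, so a grid of polynomial size and Borel–Cantelli yield almost sure uniform
convergence (`ae_eventually_abs_avg_sub_lt`). -/

theorem gauss_eq (σ : ℝ) (hσ : 0 < σ) (c x : Feature) :
    gauss σ c x = gaussianPDFReal c.1 (σ ^ 2).toNNReal x.1 *
      gaussianPDFReal c.2 (σ ^ 2).toNNReal x.2 := by
  have h : √(2 * Real.pi * σ ^ 2) * √(2 * Real.pi * σ ^ 2) = 2 * Real.pi * σ ^ 2 :=
    Real.mul_self_sqrt (by positivity)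
  simp only [gauss, gaussianPDFReal, Real.coe_toNNReal _ (sq_nonneg σ)]
  rw [mul_mul_mul_comm, ← Real.exp_add, ← mul_inv, h, one_div]
  congr 2
  ring

theorem gauss_pos {σ : ℝ} (hσ : 0 < σ) (c x : Feature) : 0 < gauss σ c x := by
  unfold gauss; positivity

theorem gauss_nonneg (σ : ℝ) (c x : Feature) : 0 ≤ gauss σ c x := by
  unfold gauss; positivity

theorem gauss_comm (σ : ℝ) (c x : Feature) : gauss σ c x = gauss σ x c := by
  unfold gauss; congr 2; ring

theorem gauss_le (σ : ℝ) (c x : Feature) : gauss σ c x ≤ 1 / (2 * Real.pi * σ ^ 2) := by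
  unfold gauss
  refine mul_le_of_le_one_right (by positivity) (Real.exp_le_one_iff.2 ?_)
  apply div_nonpos_of_nonpos_of_nonneg
  · nlinarith [sq_nonneg (x.1 - c.1), sq_nonneg (x.2 - c.2)]
  · positivity

theorem continuous_gauss (σ : ℝ) : Continuous fun p : Feature × Feature => gauss σ p.1 p.2 := by
  unfold gauss; fun_prop

theorem measurable_gauss (σ : ℝ) (c : Feature) : Measurable (gauss σ c) :=
  ((continuous_gauss σ).comp (Continuous.prodMk_right c)).measurable

theorem integrable_gauss {σ : ℝ} (hσ : 0 < σ) (c : Feature) : Integrable (gauss σ c) := by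
  have h := (integrable_gaussianPDFReal c.1 (σ ^ 2).toNNReal).mul_prod
    (integrable_gaussianPDFReal c.2 (σ ^ 2).toNNReal)
  refine h.congr (ae_of_all _ fun x => ?_)
  exact (gauss_eq σ hσ c x).symm

theorem integral_gauss {σ : ℝ} (hσ : 0 < σ) (c : Feature) : ∫ x, gauss σ c x = 1 := by
  have hv : (σ ^ 2).toNNReal ≠ 0 := (Real.toNNReal_pos.2 (by positivity)).ne'
  have h := integral_prod_mul (μ := (volume : Measure ℝ)) (ν := (volume : Measure ℝ))
    (gaussianPDFReal c.1 (σ ^ 2).toNNReal) (gaussianPDFReal c.2 (σ ^ 2).toNNReal)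
  rw [integral_gaussianPDFReal_eq_one _ hv, integral_gaussianPDFReal_eq_one _ hv, one_mul] at h
  rw [← h]
  exact integral_congr_ae (ae_of_all _ fun x => gauss_eq σ hσ c x)

/-! ### Lipschitz estimates for Gaussians and their products -/

/-- The derivative has absolute value |x| exp(-x²/2), which is at most 1 because |x| ≤ 1 + x²/2 ≤
exp(x²/2). -/
theorem abs_exp_neg_sq_sub_le (s t : ℝ) :
    |Real.exp (-(s ^ 2 / 2)) - Real.exp (-(t ^ 2 / 2))| ≤ |s - t| := by
  have hd : ∀ x : ℝ, HasDerivAt (fun x : ℝ => Real.exp (-(x ^ 2 / 2)))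
      (Real.exp (-(x ^ 2 / 2)) * (-x)) x := fun x => by
    have h := (((hasDerivAt_pow 2 x).div_const 2).fun_neg).exp
    convert h using 2
    simp
  have hb : ∀ x : ℝ, ‖deriv (fun x : ℝ => Real.exp (-(x ^ 2 / 2))) x‖ ≤ 1 := fun x => by
    rw [(hd x).deriv, Real.norm_eq_abs, abs_mul, abs_neg, Real.abs_exp, Real.exp_neg,
      inv_mul_le_iff₀ (Real.exp_pos _), mul_one]
    have h1 := Real.add_one_le_exp (x ^ 2 / 2)
    have h2 : |x| ≤ x ^ 2 / 2 + 1 := by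
      rw [← sq_abs]
      nlinarith [sq_nonneg (|x| - 1)]
    linarith
  have h := Convex.norm_image_sub_le_of_norm_deriv_le (s := Set.univ)
    (f := fun x : ℝ => Real.exp (-(x ^ 2 / 2))) (C := 1) (x := t) (y := s)
    (fun x _ => (hd x).differentiableAt) (fun x _ => hb x) convex_univ trivial trivial
  simpa [Real.norm_eq_abs] using h

theorem gauss_eq_mul {σ : ℝ} (hσ : 0 < σ) (c x : Feature) :
    gauss σ c x = 1 / (2 * Real.pi * σ ^ 2) * (Real.exp (-(((x.1 - c.1) / σ) ^ 2 / 2)) *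
      Real.exp (-(((x.2 - c.2) / σ) ^ 2 / 2))) := by
  rw [gauss, ← Real.exp_add]
  congr 2
  field_simp
  ring

theorem abs_gauss_sub_le {σ : ℝ} (hσ : 0 < σ) (c x y : Feature) :
    |gauss σ c x - gauss σ c y| ≤ 2 * ‖x - y‖ / σ * (1 / (2 * Real.pi * σ ^ 2)) := by
  rw [gauss_eq_mul hσ, gauss_eq_mul hσ, ← mul_sub, abs_mul, mul_comm,
    abs_of_nonneg (by positivity : (0 : ℝ) ≤ 1 / (2 * Real.pi * σ ^ 2))]
  refine mul_le_mul_of_nonneg_right ?_ (by positivity)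
  have key : ∀ a b c d : ℝ, 0 ≤ a → a ≤ 1 → 0 ≤ d → d ≤ 1 →
      |a * b - c * d| ≤ |a - c| + |b - d| := fun a b c d ha ha' hd hd' => by
    have : a * b - c * d = (a - c) * d + a * (b - d) := by ring
    rw [this]
    refine (abs_add_le _ _).trans (add_le_add ?_ ?_)
    · rw [abs_mul, abs_of_nonneg hd]
      exact mul_le_of_le_one_right (abs_nonneg _) hd'
    · rw [abs_mul, abs_of_nonneg ha]
      exact mul_le_of_le_one_left (abs_nonneg _) ha'
  have hle : ∀ t : ℝ, Real.exp (-(t ^ 2 / 2)) ≤ 1 := fun t =>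
    Real.exp_le_one_iff.2 (by nlinarith [sq_nonneg t])
  refine (key _ _ _ _ (Real.exp_nonneg _) (hle _) (Real.exp_nonneg _) (hle _)).trans ?_
  have h1 := abs_exp_neg_sq_sub_le ((x.1 - c.1) / σ) ((y.1 - c.1) / σ)
  have h2 := abs_exp_neg_sq_sub_le ((x.2 - c.2) / σ) ((y.2 - c.2) / σ)
  have e : ∀ a b c : ℝ, |(a - c) / σ - (b - c) / σ| = |a - b| / σ := fun a b c => by
    rw [← sub_div, abs_div, abs_of_pos hσ]; congr 2; ring
  rw [e] at h1 h2
  have n1 : |x.1 - y.1| ≤ ‖x - y‖ := norm_fst_le (x - y)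
  have n2 : |x.2 - y.2| ≤ ‖x - y‖ := norm_snd_le (x - y)
  calc _ ≤ |x.1 - y.1| / σ + |x.2 - y.2| / σ := add_le_add h1 h2
    _ ≤ ‖x - y‖ / σ + ‖x - y‖ / σ := by gcongr
    _ = _ := by ring

/-- Exchange one factor at a time. Differences are measured relative to the bound A, so that the
total error has the scale of the product itself. -/
theorem abs_prod_sub_prod_le {ι : Type*} (s : Finset ι) (a b : ι → ℝ) {A d : ℝ}
    (ha : ∀ i ∈ s, |a i| ≤ A) (hb : ∀ i ∈ s, |b i| ≤ A) (hd : ∀ i ∈ s, |a i - b i| ≤ d * A)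
    (hA : 0 ≤ A) : |∏ i ∈ s, a i - ∏ i ∈ s, b i| ≤ s.card * d * A ^ s.card := by
  classical
  induction s using Finset.induction_on with
  | empty => simp
  | insert i s hi ih =>
    rw [Finset.prod_insert hi, Finset.prod_insert hi, Finset.card_insert_of_notMem hi]
    have h1 := ih (fun j hj => ha j (Finset.mem_insert_of_mem hj))
      (fun j hj => hb j (Finset.mem_insert_of_mem hj))
      (fun j hj => hd j (Finset.mem_insert_of_mem hj))
    have h2 : |∏ j ∈ s, b j| ≤ A ^ s.card := by
      rw [Finset.abs_prod, ← Finset.prod_const]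
      exact Finset.prod_le_prod (fun _ _ => abs_nonneg _)
        fun j hj => hb j (Finset.mem_insert_of_mem hj)
    have h3 := ha i (Finset.mem_insert_self i s)
    have h4 := hd i (Finset.mem_insert_self i s)
    have e : a i * ∏ j ∈ s, a j - b i * ∏ j ∈ s, b j =
        a i * (∏ j ∈ s, a j - ∏ j ∈ s, b j) + (a i - b i) * ∏ j ∈ s, b j := by ring
    rw [e]
    refine (abs_add_le _ _).trans ?_
    rw [abs_mul, abs_mul]
    calc _ ≤ A * (s.card * d * A ^ s.card) + d * A * A ^ s.card :=
          add_le_add (mul_le_mul h3 h1 (abs_nonneg _) hA)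
            (mul_le_mul h4 h2 (abs_nonneg _) ((abs_nonneg _).trans h4))
      _ = _ := by push_cast; ring

/-! ### Gaussian masses -/

theorem measurableSet_wedge : MeasurableSet wedge :=
  (measurableSet_le measurable_const measurable_fst).inter
    (measurableSet_lt measurable_fst measurable_snd)

theorem measurableSet_halfPlane : MeasurableSet halfPlane :=
  measurableSet_lt measurable_fst measurable_snd

theorem openWedge_subset_wedge : openWedge ⊆ wedge := fun _ h => ⟨h.1.le, h.2⟩

theorem isOpen_openWedge : IsOpen openWedge :=
  (isOpen_lt continuous_const continuous_fst).inter (isOpen_lt continuous_fst continuous_snd)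

/-- The mass that the planar normal distribution with mean `c` gives to `A`. -/
def mass (σ : ℝ) (A : Set Feature) (c : Feature) : ℝ := ∫ x in A, gauss σ c x

theorem mass_nonneg (σ : ℝ) (A : Set Feature) (c : Feature) : 0 ≤ mass σ A c :=
  integral_nonneg fun _ => gauss_nonneg _ _ _

theorem mass_le_one {σ : ℝ} (hσ : 0 < σ) (A : Set Feature) (c : Feature) : mass σ A c ≤ 1 := by
  rw [← integral_gauss hσ c]
  exact setIntegral_le_integral (integrable_gauss hσ c) (ae_of_all _ fun _ => gauss_nonneg _ _ _)

theorem measurable_mass (σ : ℝ) (A : Set Feature) : Measurable (mass σ A) :=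
  (StronglyMeasurable.integral_prod_right (f := gauss σ) (ν := volume.restrict A)
    (continuous_gauss σ).stronglyMeasurable).measurable

/-- A lower bound for the mass that a Gaussian centered in the wedge gives to the wedge. -/
def massBound : ℝ := Real.exp (-(5 / 2)) / (2 * Real.pi)

theorem massBound_pos : 0 < massBound := by unfold massBound; positivity

theorem massBound_le_mass {σ : ℝ} (hσ : 0 < σ) {c : Feature} (hc : c ∈ wedge) :
    massBound ≤ mass σ wedge c := by
  -- The shift by σ in the death coordinate keeps this box of area σ² above the diagonal however
  -- close c is to it. On the box the squared distance to c is at most σ² + (2σ)² = 5σ², whence the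
  -- 5/2 in `massBound`.
  set B : Set Feature := Set.Icc c.1 (c.1 + σ) ×ˢ Set.Icc (c.2 + σ) (c.2 + σ + σ) with hB
  have hBm : MeasurableSet B := measurableSet_Icc.prod measurableSet_Icc
  have hBW : B ⊆ wedge := fun x hx => by
    have h1 := hx.1.1
    have h2 := hx.1.2
    have h3 := hx.2.1
    have h4 := hc.2
    exact ⟨hc.1.trans h1, by linarith⟩
  have hvol : volume.real B = σ ^ 2 := by
    rw [hB, Measure.volume_eq_prod, measureReal_prod_prod]
    simp only [Real.volume_real_Icc, add_sub_cancel_left]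
    rw [max_eq_left hσ.le, sq]
  have hfin : volume B ≠ ⊤ := (isCompact_Icc.prod isCompact_Icc).measure_ne_top
  have hle : ∀ x ∈ B, massBound / σ ^ 2 ≤ gauss σ c x := fun x hx => by
    have h1 : (x.1 - c.1) ^ 2 ≤ σ ^ 2 := by
      have := hx.1.1
      have := hx.1.2
      apply sq_le_sq' <;> linarith
    have h2 : (x.2 - c.2) ^ 2 ≤ (2 * σ) ^ 2 := by
      have := hx.2.1
      have := hx.2.2
      apply sq_le_sq' <;> linarith
    have e : massBound / σ ^ 2 = 1 / (2 * Real.pi * σ ^ 2) * Real.exp (-(5 / 2)) := by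
      unfold massBound; field_simp
    rw [e, gauss]
    refine mul_le_mul_of_nonneg_left (Real.exp_le_exp.2 ?_) (by positivity)
    rw [le_div_iff₀ (by positivity)]
    nlinarith
  calc massBound = ∫ _ in B, massBound / σ ^ 2 := by
        rw [setIntegral_const, hvol, smul_eq_mul]; field_simp
    _ ≤ ∫ x in B, gauss σ c x :=
        setIntegral_mono_on (integrableOn_const hfin) (integrable_gauss hσ c).integrableOn hBm hle
    _ ≤ mass σ wedge c :=
        setIntegral_mono_set (integrable_gauss hσ c).integrableOn
          (ae_of_all _ fun _ => gauss_nonneg _ _ _) (ae_of_all _ hBW)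

theorem presence_nonneg (σ : ℝ) (c : Feature) : 0 ≤ presence σ c := mass_nonneg _ _ _

theorem presence_le_one {σ : ℝ} (hσ : 0 < σ) (c : Feature) : presence σ c ≤ 1 :=
  mass_le_one hσ _ _

theorem one_sub_presence_eq {σ : ℝ} (hσ : 0 < σ) (c : Feature) :
    1 - presence σ c = ∫ x in halfPlaneᶜ, gauss σ c x := by
  rw [presence, ← integral_gauss hσ c, sub_eq_iff_eq_add, add_comm,
    integral_add_compl measurableSet_halfPlane (integrable_gauss hσ c)]

/-- The Gaussian charges the open half plane below the diagonal. Strictness permits the cancellation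
in `weight_eq`. -/
theorem presence_lt_one {σ : ℝ} (hσ : 0 < σ) (c : Feature) : presence σ c < 1 := by
  rw [← sub_pos, one_sub_presence_eq hσ,
    setIntegral_pos_iff_support_of_nonneg_ae (ae_of_all _ fun _ => gauss_nonneg _ _ _)
      (integrable_gauss hσ c).integrableOn]
  have h1 : Function.support (gauss σ c) = Set.univ := by
    ext x; simp [(gauss_pos hσ c x).ne']
  rw [h1, Set.univ_inter]
  have h2 : IsOpen {x : Feature | x.2 < x.1} := isOpen_lt continuous_snd continuous_fst
  exact (h2.measure_pos volume ⟨(1, 0), by simp⟩).trans_le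
    (measure_mono fun x (hx : x.2 < x.1) => not_lt.2 hx.le)

/-- Domination of the Gaussian far from its mean by a wider Gaussian. -/
theorem sq_mul_gauss_le {σ : ℝ} (hσ : 0 < σ) (c x : Feature) :
    ((x.1 - c.1) ^ 2 + (x.2 - c.2) ^ 2) * gauss σ c x ≤ 8 * σ ^ 2 * gauss (√2 * σ) c x := by
  have h2 : (√2 * σ) ^ 2 = 2 * σ ^ 2 := by rw [mul_pow, Real.sq_sqrt (by norm_num)]
  set r := (x.1 - c.1) ^ 2 + (x.2 - c.2) ^ 2 with hr
  set y := r / (2 * σ ^ 2) with hy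
  have e1 : gauss σ c x = 1 / (2 * Real.pi * σ ^ 2) * Real.exp (-y) := by
    rw [gauss, hy, neg_div]
  have e2 : gauss (√2 * σ) c x = 1 / (2 * Real.pi * (2 * σ ^ 2)) * Real.exp (-(y / 2)) := by
    rw [gauss, h2, hy]
    congr 2
    rw [neg_div, ← hr]
    field_simp
  have e3 : Real.exp (-y) = Real.exp (-(y / 2)) * Real.exp (-(y / 2)) := by
    rw [← Real.exp_add]; congr 1; ring
  have e4 : r = 2 * σ ^ 2 * y := by rw [hy]; field_simp
  -- Half of the exponential decay absorbs the factor y; the other half is the Gaussian of doubled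
  -- variance.
  have h3 : y * Real.exp (-(y / 2)) ≤ 2 := by
    rw [Real.exp_neg, mul_inv_le_iff₀ (Real.exp_pos _)]
    have := Real.add_one_le_exp (y / 2)
    linarith
  rw [e1, e2, e3, e4]
  have h4 : 0 ≤ 1 / Real.pi * Real.exp (-(y / 2)) := by positivity
  calc _ = (1 / Real.pi * Real.exp (-(y / 2))) * (y * Real.exp (-(y / 2))) := by field_simp
    _ ≤ (1 / Real.pi * Real.exp (-(y / 2))) * 2 := mul_le_mul_of_nonneg_left h3 h4
    _ = _ := by field_simp; norm_num

/-- A Chebyshev bound: points below the diagonal have distance at least (d - b)/√2 from the mean.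
Quadratic decay in (d - b)/σ is integrable in the gap, and this produces the factor σ per feature
that is not hit. -/
theorem one_sub_presence_le {σ : ℝ} (hσ : 0 < σ) {c : Feature} (hc : c.1 < c.2) :
    1 - presence σ c ≤ 16 * σ ^ 2 / (c.2 - c.1) ^ 2 := by
  have hg : 0 < (c.2 - c.1) ^ 2 := by have := sub_pos.2 hc; positivity
  have hσ' : 0 < √2 * σ := by positivity
  have hle : ∀ x ∈ halfPlaneᶜ, gauss σ c x ≤ 16 * σ ^ 2 / (c.2 - c.1) ^ 2 * gauss (√2 * σ) c x :=
    fun x hx => by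
      have hx' : x.2 ≤ x.1 := not_lt.1 hx
      have h1 : (c.2 - c.1) ^ 2 ≤ 2 * ((x.1 - c.1) ^ 2 + (x.2 - c.2) ^ 2) := by
        have : (c.2 - c.1) ^ 2 ≤ ((x.1 - c.1) - (x.2 - c.2)) ^ 2 := by
          apply sq_le_sq' <;> linarith
        nlinarith [sq_nonneg ((x.1 - c.1) + (x.2 - c.2))]
      have h2 := sq_mul_gauss_le hσ c x
      rw [div_mul_eq_mul_div, le_div_iff₀ hg]
      nlinarith [gauss_nonneg σ c x]
  rw [one_sub_presence_eq hσ]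
  calc _ ≤ ∫ x in halfPlaneᶜ, 16 * σ ^ 2 / (c.2 - c.1) ^ 2 * gauss (√2 * σ) c x :=
        setIntegral_mono_on (integrable_gauss hσ c).integrableOn
          ((integrable_gauss hσ' c).const_mul _).integrableOn measurableSet_halfPlane.compl hle
    _ = 16 * σ ^ 2 / (c.2 - c.1) ^ 2 * mass (√2 * σ) halfPlaneᶜ c := by
        rw [integral_const_mul]; rfl
    _ ≤ _ := mul_le_of_le_one_right (by positivity) (mass_le_one hσ' _ _)

/-! ### Rescaling -/

theorem integral_eq_integral_add_smul {E : Type*} [NormedAddCommGroup E] [NormedSpace ℝ E]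
    [MeasurableSpace E] [BorelSpace E] [FiniteDimensional ℝ E] (μ : Measure E)
    [μ.IsAddHaarMeasure] (g : E → ℝ) (a : E) {σ : ℝ} (hσ : 0 < σ) :
    ∫ x, g x ∂μ = ∫ u, σ ^ Module.finrank ℝ E * g (a + σ • u) ∂μ := by
  rw [integral_const_mul, Measure.integral_comp_smul μ (fun x => g (a + x)) σ,
    integral_add_left_eq_self (fun x => g x) a, smul_eq_mul, abs_of_nonneg (by positivity),
    mul_inv_cancel_left₀ (by positivity)]

theorem gauss_add_smul {σ : ℝ} (hσ : 0 < σ) (a u : Feature) :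
    σ ^ 2 * gauss σ a (a + σ • u) = gauss 1 0 u := by
  simp only [gauss, Prod.fst_add, Prod.snd_add, Prod.smul_fst, Prod.smul_snd, smul_eq_mul,
    add_sub_cancel_left, Prod.fst_zero, Prod.snd_zero, sub_zero]
  have : -((σ * u.1) ^ 2 + (σ * u.2) ^ 2) / (2 * σ ^ 2) = -(u.1 ^ 2 + u.2 ^ 2) / (2 * 1 ^ 2) := by
    field_simp
  rw [this]
  field_simp

theorem tendsto_add_smul {E : Type*} [NormedAddCommGroup E] [NormedSpace ℝ E] (c u : E) :
    Tendsto (fun p : ℝ × E => p.2 + p.1 • u) (𝓝[>] 0 ×ˢ 𝓝 c) (𝓝 c) := by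
  have h : Tendsto (fun p : ℝ × E => p.2 + p.1 • u) (𝓝 0 ×ˢ 𝓝 c) (𝓝 (c + (0 : ℝ) • u)) := by
    rw [← nhds_prod_eq]
    exact Continuous.tendsto (by fun_prop : Continuous fun p : ℝ × E => p.2 + p.1 • u) (0, c)
  rw [zero_smul, add_zero] at h
  exact h.mono_left (Filter.prod_mono_left _ nhdsWithin_le_nhds)

/-- In the variable u with x = c + σu the integrand is an indicator times the standard Gaussian, so
dominated convergence applies. The limit is taken jointly in bandwidth and center because local
uniformity is needed in the end. -/
theorem tendsto_mass {A : Set Feature} (hA : MeasurableSet A) {c : Feature} (hc : A ∈ 𝓝 c) :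
    Tendsto (fun p : ℝ × Feature => mass p.1 A p.2) (𝓝[>] 0 ×ˢ 𝓝 c) (𝓝 1) := by
  have hpos : ∀ᶠ p : ℝ × Feature in 𝓝[>] 0 ×ˢ 𝓝 c, 0 < p.1 :=
    (eventually_mem_nhdsWithin).prod_inl _
  have h1 : (fun p : ℝ × Feature => ∫ u, A.indicator 1 (p.2 + p.1 • u) * gauss 1 0 u) =ᶠ[
      𝓝[>] 0 ×ˢ 𝓝 c] fun p => mass p.1 A p.2 := by
    filter_upwards [hpos] with p hp
    rw [mass, ← integral_indicator hA,
      integral_eq_integral_add_smul volume (A.indicator (gauss p.1 p.2)) p.2 hp]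
    refine integral_congr_ae (ae_of_all _ fun u => ?_)
    have hf : Module.finrank ℝ Feature = 2 := by simp [Feature]
    by_cases hu : p.2 + p.1 • u ∈ A
    · simp [hu, hf, gauss_add_smul hp]
    · simp [hu]
  refine Tendsto.congr' h1 ?_
  have h0 := integral_gauss one_pos (0 : Feature)
  suffices h : Tendsto (fun p : ℝ × Feature => ∫ u, A.indicator 1 (p.2 + p.1 • u) * gauss 1 0 u)
      (𝓝[>] 0 ×ˢ 𝓝 c) (𝓝 (∫ x, gauss 1 0 x)) by rwa [h0] at h
  refine tendsto_integral_filter_of_dominated_convergence (gauss 1 0) ?_ ?_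
    (integrable_gauss one_pos 0) ?_
  · refine Eventually.of_forall fun p => Measurable.aestronglyMeasurable ?_
    exact ((measurable_one.indicator hA).comp (by fun_prop)).mul (measurable_gauss 1 0)
  · refine Eventually.of_forall fun p => ae_of_all _ fun u => ?_
    rw [Real.norm_eq_abs, abs_mul, abs_of_nonneg (gauss_nonneg 1 0 u)]
    refine mul_le_of_le_one_left (gauss_nonneg _ _ _) ?_
    by_cases hu : p.2 + p.1 • u ∈ A <;> simp [hu]
  · refine ae_of_all _ fun u => tendsto_const_nhds.congr' ?_
    filter_upwards [(tendsto_add_smul c u).eventually hc] with p hp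
    have hp' : p.2 + p.1 • u ∈ A := hp
    simp [hp']

/-! ### Concentration of averages and uniform convergence -/

section Concentration

variable {Ω : Type*} [MeasurableSpace Ω] {P : Measure Ω} [IsProbabilityMeasure P]

theorem integrable_of_bounded {Y : Ω → ℝ} {B : ℝ} (hY : Measurable Y) (h0 : ∀ ω, 0 ≤ Y ω)
    (hB : ∀ ω, Y ω ≤ B) : Integrable Y P :=
  Integrable.of_bound hY.aestronglyMeasurable B
    (ae_of_all _ fun ω => by rw [Real.norm_eq_abs, abs_of_nonneg (h0 ω)]; exact hB ω)

theorem integrable_exp_mul_of_bounded {Y : Ω → ℝ} {B : ℝ} (hY : Measurable Y) (h0 : ∀ ω, 0 ≤ Y ω)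
    (hB : ∀ ω, Y ω ≤ B) (t : ℝ) : Integrable (fun ω => Real.exp (t * Y ω)) P := by
  refine Integrable.of_bound (hY.const_mul t).exp.aestronglyMeasurable (Real.exp (|t| * B))
    (ae_of_all _ fun ω => ?_)
  rw [Real.norm_eq_abs, Real.abs_exp, Real.exp_le_exp]
  calc t * Y ω ≤ |t| * Y ω := mul_le_mul_of_nonneg_right (le_abs_self t) (h0 ω)
    _ ≤ |t| * B := mul_le_mul_of_nonneg_left (hB ω) (abs_nonneg t)

/-- Uses exp x ≤ 1 + x + x² for |x| ≤ 1, and Y² ≤ B Y. The second moment is thus bounded by BC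
instead of B², which makes the final rate n/B and so allows α up to 1/(2M). -/
theorem mgf_le_of_bounded {Y : Ω → ℝ} {B C t : ℝ} (hY : Measurable Y) (h0 : ∀ ω, 0 ≤ Y ω)
    (hB : ∀ ω, Y ω ≤ B) (hC : ∫ ω, Y ω ∂P ≤ C) (ht : |t| * B ≤ 1) (hB0 : 0 ≤ B) :
    mgf Y P t ≤ Real.exp (t * ∫ ω, Y ω ∂P + t ^ 2 * B * C) := by
  have hint : Integrable Y P := integrable_of_bounded hY h0 hB
  have hle : ∀ ω, Real.exp (t * Y ω) ≤ 1 + (t + t ^ 2 * B) * Y ω := fun ω => by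
    have h1 : |t * Y ω| ≤ 1 := by
      rw [abs_mul, abs_of_nonneg (h0 ω)]
      exact (mul_le_mul_of_nonneg_left (hB ω) (abs_nonneg t)).trans ht
    have h2 := (abs_le.1 (Real.abs_exp_sub_one_sub_id_le h1)).2
    have h3 : t ^ 2 * (Y ω * Y ω) ≤ t ^ 2 * (B * Y ω) :=
      mul_le_mul_of_nonneg_left (mul_le_mul_of_nonneg_right (hB ω) (h0 ω)) (sq_nonneg t)
    nlinarith
  calc mgf Y P t ≤ ∫ ω, (1 + (t + t ^ 2 * B) * Y ω) ∂P :=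
        integral_mono (integrable_exp_mul_of_bounded hY h0 hB t)
          ((integrable_const _).add (hint.const_mul _)) hle
    _ = 1 + (t + t ^ 2 * B) * ∫ ω, Y ω ∂P := by
        rw [integral_add (integrable_const _) (hint.const_mul _), integral_const_mul]
        simp
    _ ≤ 1 + (t * ∫ ω, Y ω ∂P + t ^ 2 * B * C) := by
        have := mul_le_mul_of_nonneg_left hC (by positivity : 0 ≤ t ^ 2 * B)
        linarith
    _ ≤ _ := by rw [add_comm]; exact Real.add_one_le_exp _

/-- The rate in the exponential inequality `measureReal_abs_avg_sub_ge_le`. -/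
def tailRate (ε C : ℝ) : ℝ := min 1 (ε / (2 * C)) * ε / 2

theorem tailRate_pos {ε C : ℝ} (hε : 0 < ε) (hC : 0 < C) : 0 < tailRate ε C := by
  unfold tailRate; positivity

/-- An exponential inequality of Bernstein type for averages of independent random variables with
values in `[0, B]` whose common mean is at most `C`. -/
theorem measureReal_abs_avg_sub_ge_le {Y : ℕ → Ω → ℝ} {B C ε e : ℝ} (hind : iIndepFun Y P)
    (hY : ∀ i, Measurable (Y i)) (h0 : ∀ i ω, 0 ≤ Y i ω) (hB : ∀ i ω, Y i ω ≤ B)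
    (he : ∀ i, ∫ ω, Y i ω ∂P = e) (heC : e ≤ C) (hB0 : 0 < B) (hC : 0 < C) (hε : 0 < ε)
    {n : ℕ} (hn : 0 < n) :
    P.real {ω | ε ≤ |1 / (n : ℝ) * ∑ i ∈ Finset.range n, Y i ω - e|} ≤
      2 * Real.exp (-(tailRate ε C * (n / B))) := by
  -- The Chernoff parameter will be ±s/B: s ≤ 1 keeps |tY| ≤ 1, and s ≤ ε/(2C) makes the quadratic
  -- term at most half of the linear gain.
  set s := min 1 (ε / (2 * C)) with hs
  have hs0 : 0 < s := by positivity
  have hs1 : s ≤ 1 := min_le_left _ _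
  have hsC : s * C ≤ ε / 2 := by
    have := mul_le_mul_of_nonneg_right (min_le_right 1 (ε / (2 * C))) hC.le
    rw [← hs] at this
    calc s * C ≤ ε / (2 * C) * C := this
      _ = ε / 2 := by field_simp
  have hn' : (0 : ℝ) < n := Nat.cast_pos.2 hn
  set S : Ω → ℝ := ∑ i ∈ Finset.range n, Y i with hS
  have hSv : ∀ ω, S ω = ∑ i ∈ Finset.range n, Y i ω := fun ω => by simp [hS]
  have hSm : Measurable S := by
    rw [funext hSv]; exact Finset.measurable_sum _ fun i _ => hY i
  have hS0 : ∀ ω, 0 ≤ S ω := fun ω => by rw [hSv]; exact Finset.sum_nonneg fun i _ => h0 i ω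
  have hSB : ∀ ω, S ω ≤ n * B := fun ω => by
    rw [hSv]
    refine (Finset.sum_le_sum fun i _ => hB i ω).trans ?_
    simp
  have hmgf : ∀ t : ℝ, |t| = s / B →
      mgf S P t ≤ Real.exp (n * (t * e + t ^ 2 * B * C)) := fun t ht => by
    rw [hS, hind.mgf_sum hY, Real.exp_nat_mul]
    refine (Finset.prod_le_prod (fun i _ => mgf_nonneg) fun i _ => ?_).trans
      (by rw [Finset.prod_const, Finset.card_range])
    have := mgf_le_of_bounded (hY i) (h0 i) (hB i) (le_of_eq_of_le (he i) heC) (t := t)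
      (by rw [ht, div_mul_cancel₀ _ hB0.ne']; exact hs1) hB0.le
    rwa [he i] at this
  have hexp : ∀ t : ℝ, |t| = s / B → n * (t ^ 2 * B * C) ≤ n * (s / B * ε / 2) := fun t ht => by
    have : t ^ 2 = (s / B) ^ 2 := by rw [← ht, sq_abs]
    rw [this]
    refine mul_le_mul_of_nonneg_left ?_ hn'.le
    calc (s / B) ^ 2 * B * C = s / B * (s * C) := by field_simp
      _ ≤ s / B * (ε / 2) := mul_le_mul_of_nonneg_left hsC (by positivity)
      _ = _ := by ring
  have hrate : tailRate ε C * (n / B) = n * (s / B * ε / 2) := by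
    rw [tailRate, ← hs]; field_simp
  have hup : P.real {ω | n * (e + ε) ≤ S ω} ≤ Real.exp (-(tailRate ε C * (n / B))) := by
    have ht : |s / B| = s / B := abs_of_nonneg (by positivity)
    refine (measure_ge_le_exp_mul_mgf _ (by positivity : 0 ≤ s / B)
      (integrable_exp_mul_of_bounded hSm hS0 hSB _)).trans ?_
    refine (mul_le_mul_of_nonneg_left (hmgf _ ht) (Real.exp_nonneg _)).trans ?_
    rw [← Real.exp_add, Real.exp_le_exp, hrate]
    nlinarith [hexp _ ht]
  have hlow : P.real {ω | S ω ≤ n * (e - ε)} ≤ Real.exp (-(tailRate ε C * (n / B))) := by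
    have ht : |-(s / B)| = s / B := by rw [abs_neg, abs_of_nonneg (by positivity)]
    refine (measure_le_le_exp_mul_mgf _ (neg_nonpos.2 (by positivity : 0 ≤ s / B))
      (integrable_exp_mul_of_bounded hSm hS0 hSB _)).trans ?_
    refine (mul_le_mul_of_nonneg_left (hmgf _ ht) (Real.exp_nonneg _)).trans ?_
    rw [← Real.exp_add, Real.exp_le_exp, hrate]
    nlinarith [hexp _ ht]
  have hsub : {ω | ε ≤ |1 / (n : ℝ) * ∑ i ∈ Finset.range n, Y i ω - e|} ⊆
      {ω | n * (e + ε) ≤ S ω} ∪ {ω | S ω ≤ n * (e - ε)} := fun ω hω => by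
    have hω' : ε ≤ |1 / (n : ℝ) * S ω - e| := by rw [hSv]; exact hω
    have hm : 1 / (n : ℝ) * S ω * n = S ω := by field_simp
    rcases le_abs.1 hω' with h | h
    · left
      have := mul_le_mul_of_nonneg_right h hn'.le
      show n * (e + ε) ≤ S ω
      nlinarith
    · right
      have := mul_le_mul_of_nonneg_right h hn'.le
      show S ω ≤ n * (e - ε)
      nlinarith
  calc _ ≤ P.real ({ω | n * (e + ε) ≤ S ω} ∪ {ω | S ω ≤ n * (e - ε)}) := measureReal_mono hsub
    _ ≤ _ := measureReal_union_le _ _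
    _ ≤ _ := by linarith

theorem summable_pow_mul_exp_neg_rpow (q : ℕ) {c β : ℝ} (hc : 0 < c) (hβ : 0 < β) :
    Summable fun n : ℕ => (n : ℝ) ^ q * Real.exp (-(c * (n : ℝ) ^ β)) := by
  -- This exponent turns a power of n^β into n^(-q-2), which leaves the summable n⁻² after
  -- multiplication by n^q.
  have h1 := (isLittleO_exp_neg_mul_rpow_atTop hc (-((q + 2 : ℕ) : ℝ) / β)).comp_tendsto
    ((tendsto_rpow_atTop hβ).comp tendsto_natCast_atTop_atTop)
  have h2 : (fun n : ℕ => (n : ℝ) ^ q * Real.exp (-(c * (n : ℝ) ^ β))) =O[atTop]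
      fun n : ℕ => (n : ℝ) ^ q * ((n : ℝ) ^ β) ^ (-((q + 2 : ℕ) : ℝ) / β) := by
    refine (isBigO_refl _ _).mul ?_
    simpa [Function.comp_def] using h1.isBigO
  refine summable_of_isBigO_nat (Real.summable_one_div_nat_pow.2 one_lt_two) (h2.trans_eventuallyEq ?_)
  filter_upwards [eventually_gt_atTop 0] with n hn
  have hn' : (0 : ℝ) < n := Nat.cast_pos.2 hn
  rw [← Real.rpow_mul hn'.le, mul_div_cancel₀ _ hβ.ne', Real.rpow_neg hn'.le, Real.rpow_natCast,
    pow_add]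
  field_simp

/-- The exponential inequality is applied at the points of a grid of mesh n^(-p) in the box. Their
number is polynomial in n, so the failure probabilities are summable and Borel–Cantelli applies.
Since L n = o(n^p), passing to a nearest lower grid point moves the average and the expectation by
less than ε/4 each, on top of a fluctuation below ε/2 at the grid point. -/
theorem ae_eventually_abs_avg_sub_lt {𝒳 : Type*} [MeasurableSpace 𝒳] {D : ℕ → Ω → 𝒳}
    (hDmeas : ∀ i, Measurable (D i)) (hDindep : iIndepFun D P) {N : ℕ}
    {g : ℕ → (Fin N → Feature) → 𝒳 → ℝ} (hg : ∀ n ξ, Measurable (g n ξ))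
    {B L : ℕ → ℝ} (h0 : ∀ n ξ d, 0 ≤ g n ξ d) (hB : ∀ n ξ d, g n ξ d ≤ B n)
    (hL : ∀ n ξ ξ' d, |g n ξ d - g n ξ' d| ≤ L n * ‖ξ - ξ'‖)
    {e : ℕ → (Fin N → Feature) → ℝ} (he : ∀ n ξ i, ∫ ω, g n ξ (D i ω) ∂P = e n ξ)
    {C : ℝ} (hC : 0 < C) (heC : ∀ᶠ n in atTop, ∀ ξ, e n ξ ≤ C)
    {b β : ℝ} (hb : 0 < b) (hβ : 0 < β) (hB0 : ∀ n, 0 < B n) (hL0 : ∀ n, 0 ≤ L n)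
    (hBb : ∀ᶠ n : ℕ in atTop, b * (n : ℝ) ^ β ≤ n / B n)
    {p : ℕ} (hLp : Tendsto (fun n : ℕ => L n / (n : ℝ) ^ p) atTop (𝓝 0))
    (R : ℕ) {ε : ℝ} (hε : 0 < ε) :
    ∀ᵐ ω ∂P, ∀ᶠ n : ℕ in atTop, ∀ ξ : Fin N → Feature,
      (∀ k, ξ k ∈ Set.Icc (0 : ℝ) R ×ˢ Set.Icc (0 : ℝ) R) →
      |1 / (n : ℝ) * ∑ i ∈ Finset.range n, g n ξ (D i ω) - e n ξ| < ε := by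
  let J : ℕ → Type := fun n => Fin N → Fin (R * n ^ p + 1) × Fin (R * n ^ p + 1)
  let pt : (n : ℕ) → J n → Fin N → Feature := fun n γ k =>
    (((γ k).1 : ℕ) / (n : ℝ) ^ p, ((γ k).2 : ℕ) / (n : ℝ) ^ p)
  let bad : (n : ℕ) → Set Ω := fun n => ⋃ γ : J n,
    {ω | ε / 2 ≤ |1 / (n : ℝ) * ∑ i ∈ Finset.range n, g n (pt n γ) (D i ω) - e n (pt n γ)|}
  have hcard : ∀ n, Fintype.card (J n) = (R * n ^ p + 1) ^ (2 * N) := fun n => by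
    simp only [J, Fintype.card_fun, Fintype.card_prod, Fintype.card_fin]
    rw [pow_mul, sq]
  have hbad : ∀ᶠ n : ℕ in atTop, P.real (bad n) ≤
      2 * ((R : ℝ) + 1) ^ (2 * N) * ((n : ℝ) ^ (p * (2 * N)) *
        Real.exp (-(tailRate (ε / 2) C * b * (n : ℝ) ^ β))) := by
    filter_upwards [heC, hBb, eventually_gt_atTop 0] with n h1 h2 hn
    have hr : 0 < tailRate (ε / 2) C := tailRate_pos (half_pos hε) hC
    have hpt : ∀ γ : J n, P.real {ω | ε / 2 ≤
        |1 / (n : ℝ) * ∑ i ∈ Finset.range n, g n (pt n γ) (D i ω) - e n (pt n γ)|} ≤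
        2 * Real.exp (-(tailRate (ε / 2) C * b * (n : ℝ) ^ β)) := fun γ => by
      have hind : iIndepFun (fun i ω => g n (pt n γ) (D i ω)) P :=
        hDindep.comp (fun _ => g n (pt n γ)) fun _ => hg n _
      refine (measureReal_abs_avg_sub_ge_le hind (fun i => (hg n _).comp (hDmeas i))
        (fun i ω => h0 _ _ _) (fun i ω => hB _ _ _) (he n _) (h1 _) (hB0 n) hC (half_pos hε)
        hn).trans ?_
      rw [mul_assoc]
      gcongr
    calc P.real (bad n) ≤ ∑ γ : J n, P.real {ω | ε / 2 ≤
          |1 / (n : ℝ) * ∑ i ∈ Finset.range n, g n (pt n γ) (D i ω) - e n (pt n γ)|} :=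
          measureReal_iUnion_fintype_le _
      _ ≤ ∑ _γ : J n, 2 * Real.exp (-(tailRate (ε / 2) C * b * (n : ℝ) ^ β)) :=
          Finset.sum_le_sum fun γ _ => hpt γ
      _ = ((R : ℝ) * n ^ p + 1) ^ (2 * N) *
          (2 * Real.exp (-(tailRate (ε / 2) C * b * (n : ℝ) ^ β))) := by
          rw [Finset.sum_const, Finset.card_univ, hcard, nsmul_eq_mul]
          push_cast; ring
      _ ≤ (((R : ℝ) + 1) * n ^ p) ^ (2 * N) *
          (2 * Real.exp (-(tailRate (ε / 2) C * b * (n : ℝ) ^ β))) := by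
          gcongr
          have : (1 : ℝ) ≤ (n : ℝ) ^ p := one_le_pow₀ (Nat.one_le_cast.2 hn)
          linarith
      _ = _ := by rw [mul_pow, ← pow_mul]; ring
  have hsum : Summable fun n => P.real (bad n) := by
    have h1 := (summable_pow_mul_exp_neg_rpow (p * (2 * N))
      (mul_pos (tailRate_pos (half_pos hε) hC) hb) hβ).mul_left (2 * ((R : ℝ) + 1) ^ (2 * N))
    refine summable_of_isBigO_nat h1 (IsBigO.of_bound 1 ?_)
    filter_upwards [hbad] with n hn
    rw [Real.norm_of_nonneg measureReal_nonneg, one_mul]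
    exact hn.trans (le_abs_self _)
  have hne : ∑' n, P (bad n) ≠ ⊤ := by
    have : (fun n => P (bad n)) = fun n => ENNReal.ofReal (P.real (bad n)) := by
      ext n; rw [ofReal_measureReal]
    rw [this]
    exact hsum.tsum_ofReal_ne_top
  have hLe : ∀ᶠ n : ℕ in atTop, L n / (n : ℝ) ^ p < ε / 4 :=
    hLp.eventually (gt_mem_nhds (by positivity))
  filter_upwards [ae_eventually_notMem hne] with ω hω
  filter_upwards [hω, hLe, eventually_gt_atTop 0] with n h1 h2 hn ξ hξ
  have hn' : (0 : ℝ) < n := Nat.cast_pos.2 hn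
  have hnp : (0 : ℝ) < (n : ℝ) ^ p := by positivity
  have hfl : ∀ x : ℝ, x ∈ Set.Icc (0 : ℝ) R → ⌊x * (n : ℝ) ^ p⌋₊ < R * n ^ p + 1 := fun x hx => by
    rw [Nat.lt_succ_iff]
    refine Nat.floor_le_of_le ?_
    push_cast
    exact mul_le_mul_of_nonneg_right hx.2 hnp.le
  have hdist : ∀ x : ℝ, x ∈ Set.Icc (0 : ℝ) R →
      |x - (⌊x * (n : ℝ) ^ p⌋₊ : ℝ) / (n : ℝ) ^ p| ≤ 1 / (n : ℝ) ^ p := fun x hx => by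
    have h3 := Nat.floor_le (mul_nonneg hx.1 hnp.le)
    have h4 := Nat.lt_floor_add_one (x * (n : ℝ) ^ p)
    have e1 : x - (⌊x * (n : ℝ) ^ p⌋₊ : ℝ) / (n : ℝ) ^ p =
        (x * (n : ℝ) ^ p - ⌊x * (n : ℝ) ^ p⌋₊) / (n : ℝ) ^ p := by field_simp
    rw [e1, abs_div, abs_of_pos hnp, abs_of_nonneg (by linarith)]
    gcongr
    linarith
  let γ : J n := fun k => (⟨⌊(ξ k).1 * (n : ℝ) ^ p⌋₊, hfl _ (hξ k).1⟩,
    ⟨⌊(ξ k).2 * (n : ℝ) ^ p⌋₊, hfl _ (hξ k).2⟩)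
  have hnear : ‖ξ - pt n γ‖ ≤ 1 / (n : ℝ) ^ p := by
    refine (pi_norm_le_iff_of_nonneg (by positivity)).2 fun k => ?_
    exact (Prod.norm_def _).trans_le (max_le (hdist _ (hξ k).1) (hdist _ (hξ k).2))
  have hLn : L n * ‖ξ - pt n γ‖ < ε / 4 := by
    refine (mul_le_mul_of_nonneg_left hnear (hL0 n)).trans_lt ?_
    rwa [mul_one_div]
  have hγ : |1 / (n : ℝ) * ∑ i ∈ Finset.range n, g n (pt n γ) (D i ω) - e n (pt n γ)| < ε / 2 := by
    by_contra h
    exact h1 (Set.mem_iUnion.2 ⟨γ, not_lt.1 h⟩)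
  have havg : |1 / (n : ℝ) * ∑ i ∈ Finset.range n, g n ξ (D i ω) -
      1 / (n : ℝ) * ∑ i ∈ Finset.range n, g n (pt n γ) (D i ω)| ≤ L n * ‖ξ - pt n γ‖ := by
    rw [← mul_sub, ← Finset.sum_sub_distrib, abs_mul, abs_of_pos (by positivity : 0 < 1 / (n : ℝ)),
      one_div, inv_mul_le_iff₀ hn']
    refine (Finset.abs_sum_le_sum_abs _ _).trans ((Finset.sum_le_sum fun i _ => hL n ξ _ _).trans ?_)
    simp
  have hexp : |e n (pt n γ) - e n ξ| ≤ L n * ‖ξ - pt n γ‖ := by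
    have hi : ∀ ξ, Integrable (fun ω => g n ξ (D 0 ω)) P := fun ξ =>
      integrable_of_bounded ((hg n ξ).comp (hDmeas 0)) (fun _ => h0 _ _ _) (fun _ => hB _ _ _)
    rw [abs_sub_comm, ← he n _ 0, ← he n (pt n γ) 0, ← integral_sub (hi _) (hi _), ← Real.norm_eq_abs]
    refine (norm_integral_le_of_norm_le_const (C := L n * ‖ξ - pt n γ‖)
      (ae_of_all _ fun ω => hL n ξ _ _)).trans ?_
    simp
  rw [abs_lt] at hγ ⊢
  rw [abs_le] at havg hexp
  constructor <;> linarith [hγ.1, hγ.2, havg.1, havg.2, hexp.1, hexp.2]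

end Concentration

/-! ### The part of the kernel without lower inputs -/

/-- The factor contributed to the kernel by a feature `x` of the center that is not hit by any
input. -/
def miss (σ : ℝ) (x : Feature) : ℝ := if σ ≤ x.2 - x.1 then 1 - presence σ x else 1

theorem miss_nonneg {σ : ℝ} (hσ : 0 < σ) (x : Feature) : 0 ≤ miss σ x := by
  unfold miss
  split_ifs
  · exact sub_nonneg.2 (presence_le_one hσ x)
  · exact zero_le_one

theorem miss_le_one (σ : ℝ) (x : Feature) : miss σ x ≤ 1 := by
  unfold miss
  split_ifs
  · exact sub_le_self _ (presence_nonneg σ x)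
  · exact le_rfl

theorem measurable_miss (σ : ℝ) : Measurable (miss σ) := by
  have h : Measurable fun x : Feature => presence σ x := measurable_mass σ halfPlane
  exact Measurable.ite (measurableSet_le measurable_const (measurable_snd.sub measurable_fst))
    (measurable_const.sub h) measurable_const

/-- The amplitude of the Gaussian contributed to the kernel by an upper feature of the center. -/
def amplitude (σ : ℝ) (x : Feature) : ℝ := presence σ x / mass σ wedge x

theorem amplitude_nonneg (σ : ℝ) (x : Feature) : 0 ≤ amplitude σ x :=
  div_nonneg (presence_nonneg _ _) (mass_nonneg _ _ _)

theorem amplitude_le {σ : ℝ} (hσ : 0 < σ) {x : Feature} (hx : x ∈ wedge) :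
    amplitude σ x ≤ 1 / massBound := by
  exact div_le_div₀ zero_le_one (presence_le_one hσ x) massBound_pos (massBound_le_mass hσ hx)

theorem measurable_amplitude (σ : ℝ) : Measurable (amplitude σ) := by
  have h : Measurable fun x : Feature => presence σ x := measurable_mass σ halfPlane
  exact h.div (measurable_mass σ wedge)

open Classical in
/-- The coefficient of the product of Gaussians centered at `η (e k)` in the kernel. -/
def coef (ν : ℕ → PMF ℕ) (σ : ℝ) {N m : ℕ} (e : Fin N → Fin m) (η : Fin m → Feature) : ℝ :=
  if StrictMono e ∧ η ∈ power wedge m ∧ ∀ k, σ ≤ (η (e k)).2 - (η (e k)).1 then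
    (ν (numLower σ η) 0).toReal * (∏ i with i ∉ Set.range e, miss σ (η i)) *
      ∏ k, amplitude σ (η (e k))
  else 0

/-- The part of the kernel in which no input is assigned to the lower features, for centers with at
most `M` features in the wedge. -/
def upperPart (ν : ℕ → PMF ℕ) (M : ℕ) (σ : ℝ) {N : ℕ} (ξ : Fin N → Feature) (D : Diagram) : ℝ :=
  if D.1 ≤ M then
    ∑ e : Fin N → Fin D.1, coef ν σ e D.2 * ∏ k, gauss σ (D.2 (e k)) (ξ k)
  else 0

theorem pmf_toReal_le_one (p : PMF ℕ) (k : ℕ) : (p k).toReal ≤ 1 :=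
  ENNReal.toReal_le_of_le_ofReal zero_le_one (by simpa using p.coe_le_one k)

theorem coef_nonneg (ν : ℕ → PMF ℕ) {σ : ℝ} (hσ : 0 < σ) {N m : ℕ} (e : Fin N → Fin m)
    (η : Fin m → Feature) : 0 ≤ coef ν σ e η := by
  unfold coef
  split_ifs
  · exact mul_nonneg (mul_nonneg ENNReal.toReal_nonneg
      (Finset.prod_nonneg fun _ _ => miss_nonneg hσ _))
      (Finset.prod_nonneg fun _ _ => amplitude_nonneg _ _)
  · exact le_rfl

-- The factors `miss` are kept, since they supply the powers of σ in `layerMean_le`; the amplitudes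
-- and the value of ν are merely bounded.
open Classical in
theorem coef_le_mul_prod_miss (ν : ℕ → PMF ℕ) {σ : ℝ} (hσ : 0 < σ) {N m : ℕ} (e : Fin N → Fin m)
    (η : Fin m → Feature) :
    coef ν σ e η ≤ (1 / massBound) ^ N * ∏ i with i ∉ Set.range e, miss σ (η i) := by
  have hm : 0 ≤ ∏ i with i ∉ Set.range e, miss σ (η i) :=
    Finset.prod_nonneg fun _ _ => miss_nonneg hσ _
  have hb := massBound_pos
  unfold coef
  split_ifs with h
  · have h1 : ∏ k, amplitude σ (η (e k)) ≤ (1 / massBound) ^ N :=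
      (Finset.prod_le_prod (fun _ _ => amplitude_nonneg _ _)
        fun k _ => amplitude_le hσ (h.2.1 (e k))).trans (by simp)
    rw [mul_comm]
    exact mul_le_mul h1 (mul_le_of_le_one_left hm (pmf_toReal_le_one _ _))
      (mul_nonneg ENNReal.toReal_nonneg hm) (by positivity)
  · positivity

theorem coef_le (ν : ℕ → PMF ℕ) {σ : ℝ} (hσ : 0 < σ) {N m : ℕ} (e : Fin N → Fin m)
    (η : Fin m → Feature) : coef ν σ e η ≤ (1 / massBound) ^ N := by
  have hb := massBound_pos
  exact (coef_le_mul_prod_miss ν hσ e η).trans (mul_le_of_le_one_right (by positivity)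
    (Finset.prod_le_one (fun _ _ => miss_nonneg hσ _) fun _ _ => miss_le_one _ _))

theorem measurable_numLower (σ : ℝ) (m : ℕ) :
    Measurable fun η : Fin m → Feature => numLower σ η := by
  classical
  have h : (fun η : Fin m → Feature => numLower σ η) =
      fun η => ∑ i, if (η i).2 - (η i).1 < σ then 1 else 0 := by
    ext η
    rw [numLower, Fintype.card_subtype, Finset.card_filter]
  rw [h]
  refine Finset.measurable_sum _ fun i _ => Measurable.ite ?_ measurable_const measurable_const
  exact measurableSet_lt ((measurable_pi_apply i).snd.sub (measurable_pi_apply i).fst)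
    measurable_const

theorem measurableSet_power {A : Set Feature} (hA : MeasurableSet A) (N : ℕ) :
    MeasurableSet (power A N) := by
  have h : power A N = Set.pi Set.univ fun _ => A := by ext; simp [power]
  rw [h]
  exact MeasurableSet.univ_pi fun _ => hA

theorem measurable_coef (ν : ℕ → PMF ℕ) (σ : ℝ) {N m : ℕ} (e : Fin N → Fin m) :
    Measurable (coef ν σ e) := by
  classical
  refine Measurable.ite ?_ (Measurable.mul (Measurable.mul ?_ ?_) ?_) measurable_const
  · refine MeasurableSet.inter (MeasurableSet.const _) ((measurableSet_power measurableSet_wedge m).inter ?_)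
    have : {η : Fin m → Feature | ∀ k, σ ≤ (η (e k)).2 - (η (e k)).1} =
        ⋂ k, {η | σ ≤ (η (e k)).2 - (η (e k)).1} := by ext; simp
    change MeasurableSet {η : Fin m → Feature | ∀ k, σ ≤ (η (e k)).2 - (η (e k)).1}
    rw [this]
    exact MeasurableSet.iInter fun k => measurableSet_le measurable_const
      ((measurable_pi_apply _).snd.sub (measurable_pi_apply _).fst)
  · exact (Measurable.of_discrete (f := fun l : ℕ => (ν l 0).toReal)).comp (measurable_numLower σ m)
  · exact Finset.measurable_prod _ fun i _ => (measurable_miss σ).comp (measurable_pi_apply i)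
  · exact Finset.measurable_prod _ fun k _ => (measurable_amplitude σ).comp (measurable_pi_apply _)

theorem measurable_diagram {β : Type*} [MeasurableSpace β] {g : Diagram → β}
    (hg : ∀ m, Measurable fun η : Fin m → Feature => g ⟨m, η⟩) : Measurable g := fun _ hs =>
  MeasurableSpace.measurableSet_iInf.2 fun m => hg m hs

theorem measurable_upperPart_layer (ν : ℕ → PMF ℕ) (M : ℕ) (σ : ℝ) {N : ℕ} (ξ : Fin N → Feature)
    (m : ℕ) : Measurable fun η : Fin m → Feature => upperPart ν M σ ξ ⟨m, η⟩ := by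
  by_cases h : m ≤ M
  · simp only [upperPart, h, if_true]
    change Measurable fun η : Fin m → Feature =>
      ∑ e : Fin N → Fin m, coef ν σ e η * ∏ k, gauss σ (η (e k)) (ξ k)
    refine Finset.measurable_sum _ fun e _ => (measurable_coef ν σ e).fun_mul
      (Finset.measurable_prod _ fun k _ => ?_)
    simp only [gauss_comm σ _ (ξ k)]
    exact (measurable_gauss σ (ξ k)).comp (measurable_pi_apply _)
  · simp only [upperPart, h, if_false]
    exact measurable_const

theorem measurable_upperPart (ν : ℕ → PMF ℕ) (M : ℕ) (σ : ℝ) {N : ℕ} (ξ : Fin N → Feature) :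
    Measurable (upperPart ν M σ ξ) :=
  measurable_diagram (measurable_upperPart_layer ν M σ ξ)

theorem upperPart_nonneg (ν : ℕ → PMF ℕ) (M : ℕ) {σ : ℝ} (hσ : 0 < σ) {N : ℕ}
    (ξ : Fin N → Feature) (D : Diagram) : 0 ≤ upperPart ν M σ ξ D := by
  unfold upperPart
  split_ifs
  · exact Finset.sum_nonneg fun e _ => mul_nonneg (coef_nonneg ν hσ e _)
      (Finset.prod_nonneg fun _ _ => gauss_nonneg _ _ _)
  · exact le_rfl

theorem card_fin_fun_le {N m M : ℕ} (h : m ≤ M) :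
    (Fintype.card (Fin N → Fin m) : ℝ) ≤ ((M : ℝ) + 1) ^ N := by
  rw [Fintype.card_fun, Fintype.card_fin, Fintype.card_fin]
  push_cast
  gcongr
  have : (m : ℝ) ≤ M := Nat.cast_le.2 h
  linarith

/-- The restrictions to length at most M and to the wedge are built into `upperPart` and `coef`, so
the bound holds for every center and not just almost every one, as the concentration lemma requires.
-/
theorem upperPart_le (ν : ℕ → PMF ℕ) (M : ℕ) {σ : ℝ} (hσ : 0 < σ) {N : ℕ}
    (ξ : Fin N → Feature) (D : Diagram) :
    upperPart ν M σ ξ D ≤ (((M : ℝ) + 1) * (1 / massBound) * (1 / (2 * Real.pi * σ ^ 2))) ^ N := by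
  have hb := massBound_pos
  unfold upperPart
  split_ifs with h
  · have h1 : ∀ e : Fin N → Fin D.1, coef ν σ e D.2 * ∏ k, gauss σ (D.2 (e k)) (ξ k) ≤
        (1 / massBound) ^ N * (1 / (2 * Real.pi * σ ^ 2)) ^ N := fun e =>
      mul_le_mul (coef_le ν hσ e _) ((Finset.prod_le_prod (fun _ _ => gauss_nonneg _ _ _)
        fun k _ => gauss_le _ _ _).trans (by simp))
        (Finset.prod_nonneg fun _ _ => gauss_nonneg _ _ _) (by positivity)
    refine (Finset.sum_le_sum fun e _ => h1 e).trans ?_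
    rw [Finset.sum_const, Finset.card_univ, nsmul_eq_mul, mul_pow, mul_pow,
      mul_assoc (((M : ℝ) + 1) ^ N)]
    exact mul_le_mul_of_nonneg_right (card_fin_fun_le h) (by positivity)
  · positivity

theorem abs_upperPart_sub_le (ν : ℕ → PMF ℕ) (M : ℕ) {σ : ℝ} (hσ : 0 < σ) {N : ℕ}
    (ξ ξ' : Fin N → Feature) (D : Diagram) :
    |upperPart ν M σ ξ D - upperPart ν M σ ξ' D| ≤
      (((M : ℝ) + 1) * (1 / massBound) * (1 / (2 * Real.pi * σ ^ 2))) ^ N * (2 * N / σ) *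
        ‖ξ - ξ'‖ := by
  have hb := massBound_pos
  unfold upperPart
  split_ifs with h
  · have h1 : ∀ e : Fin N → Fin D.1, |coef ν σ e D.2 * ∏ k, gauss σ (D.2 (e k)) (ξ k) -
        coef ν σ e D.2 * ∏ k, gauss σ (D.2 (e k)) (ξ' k)| ≤
        (1 / massBound) ^ N * (N * (2 * ‖ξ - ξ'‖ / σ) * (1 / (2 * Real.pi * σ ^ 2)) ^ N) :=
      fun e => by
        rw [← mul_sub, abs_mul, abs_of_nonneg (coef_nonneg ν hσ e _)]
        refine mul_le_mul (coef_le ν hσ e _) ?_ (abs_nonneg _) (by positivity)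
        have hA : ∀ ζ : Fin N → Feature, ∀ k ∈ (Finset.univ : Finset (Fin N)),
            |gauss σ (D.2 (e k)) (ζ k)| ≤ 1 / (2 * Real.pi * σ ^ 2) := fun ζ k _ => by
          rw [abs_of_nonneg (gauss_nonneg _ _ _)]; exact gauss_le _ _ _
        refine (abs_prod_sub_prod_le _ _ _ (hA ξ) (hA ξ') (d := 2 * ‖ξ - ξ'‖ / σ) (fun k _ => ?_)
          (by positivity)).trans (by simp)
        refine (abs_gauss_sub_le hσ _ _ _).trans ?_
        gcongr
        exact norm_le_pi_norm (ξ - ξ') k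
    rw [← Finset.sum_sub_distrib]
    refine (Finset.abs_sum_le_sum_abs _ _).trans ((Finset.sum_le_sum fun e _ => h1 e).trans ?_)
    rw [Finset.sum_const, Finset.card_univ, nsmul_eq_mul, mul_pow, mul_pow]
    refine (mul_le_mul_of_nonneg_right (card_fin_fun_le h) (by positivity)).trans (le_of_eq ?_)
    ring
  · rw [sub_self, abs_zero]; positivity

/-! ### Splitting the kernel -/

theorem prod_mem_range {ι κ : Type*} [Fintype ι] [Fintype κ] {e : ι → κ}
    [DecidablePred (· ∈ Set.range e)] (he : Function.Injective e) (F : κ → ℝ) :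
    ∏ i with i ∈ Set.range e, F i = ∏ k, F (e k) := by
  classical
  have h : (Finset.univ.filter fun i => i ∈ Set.range e) = Finset.univ.image e := by
    ext; simp
  rw [h, Finset.prod_image he.injOn]

-- As q < 1, the denominators cancel and leave 1 - q for each upper feature that is not hit. Lower
-- features have `miss` equal to 1, so the product may run over all indices outside the range.
open Classical in
theorem weight_eq {σ : ℝ} (hσ : 0 < σ) {m j : ℕ} (η : Fin m → Feature) {γ : Fin j → Upper σ η}
    (hγ : StrictMono γ) : weight σ η γ =
      (∏ i with i ∉ Set.range (fun k => (γ k : Fin m)), miss σ (η i)) *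
        ∏ k, presence σ (η (γ k)) := by
  have hinj : Function.Injective fun k => (γ k : Fin m) :=
    Subtype.val_injective.comp hγ.injective
  have h1 : ∏ i : Upper σ η, (1 - presence σ (η i)) = ∏ i, miss σ (η i) := by
    rw [← Finset.prod_filter_mul_prod_filter_not Finset.univ (fun i => σ ≤ (η i).2 - (η i).1)
      (fun i => miss σ (η i)), Finset.prod_eq_one (s := Finset.univ.filter fun i =>
        ¬ σ ≤ (η i).2 - (η i).1), mul_one]
    · rw [Finset.prod_subtype (p := fun i => σ ≤ (η i).2 - (η i).1) _ (by simp)]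
      refine Finset.prod_congr rfl fun i _ => ?_
      rw [miss, if_pos i.2]
    · intro i hi
      rw [miss, if_neg (Finset.mem_filter.1 hi).2]
  have h2 : ∏ k, (1 - presence σ (η (γ k))) = ∏ k, miss σ (η (γ k)) :=
    Finset.prod_congr rfl fun k _ => by rw [miss, if_pos (γ k).2]
  have h3 : ∏ k, miss σ (η (γ k)) ≠ 0 := by
    rw [← h2]
    exact Finset.prod_ne_zero_iff.2 fun k _ => (sub_pos.2 (presence_lt_one hσ _)).ne'
  rw [weight, h1, h2, ← Finset.prod_filter_mul_prod_filter_not Finset.univ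
    (fun i => i ∈ Set.range fun k => (γ k : Fin m)) (fun i => miss σ (η i)),
    prod_mem_range hinj fun i => miss σ (η i), mul_div_cancel_left₀ _ h3]

theorem weight_nonneg {σ : ℝ} (hσ : 0 < σ) {m j : ℕ} (η : Fin m → Feature) {γ : Fin j → Upper σ η}
    (hγ : StrictMono γ) : 0 ≤ weight σ η γ := by
  rw [weight_eq hσ η hγ]
  exact mul_nonneg (Finset.prod_nonneg fun _ _ => miss_nonneg hσ _)
    (Finset.prod_nonneg fun _ _ => presence_nonneg _ _)

theorem weight_le_one {σ : ℝ} (hσ : 0 < σ) {m j : ℕ} (η : Fin m → Feature) {γ : Fin j → Upper σ η}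
    (hγ : StrictMono γ) : weight σ η γ ≤ 1 := by
  rw [weight_eq hσ η hγ]
  exact mul_le_one₀ (Finset.prod_le_one (fun _ _ => miss_nonneg hσ _) fun _ _ => miss_le_one _ _)
    (Finset.prod_nonneg fun _ _ => presence_nonneg _ _)
    (Finset.prod_le_one (fun _ _ => presence_nonneg _ _) fun _ _ => presence_le_one hσ _)

open Classical in
/-- The summand of the kernel in which `j` inputs are assigned to upper features. -/
def kernelTerm (ν : ℕ → PMF ℕ) (σ : ℝ) (Z D : Diagram) (j : ℕ) : ℝ :=
  if h : j ≤ Z.1 then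
    (ν (numLower σ D.2) (Z.1 - j)).toReal *
      ∑ γ ∈ Finset.univ.filter (fun γ : Fin j → Upper σ D.2 => StrictMono γ),
        weight σ D.2 γ *
          (∏ k : Fin j, upperDensity σ (D.2 (γ k)) (Z.2 (Fin.castLE h k))) *
          ∏ k ∈ Finset.univ.filter (fun k : Fin Z.1 => j ≤ (k : ℕ)),
            lowerDensity σ D.2 (Z.2 k)
  else 0

theorem kernelTerm_eq_zero_of_numUpper_lt (ν : ℕ → PMF ℕ) (σ : ℝ) (Z D : Diagram) {j : ℕ}
    (hj : numUpper σ D.2 < j) : kernelTerm ν σ Z D j = 0 := by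
  classical
  unfold kernelTerm
  split_ifs with h
  · rw [Finset.filter_false_of_mem, Finset.sum_empty, mul_zero]
    intro γ _ hγ
    have h1 := Fintype.card_le_of_injective γ hγ.injective
    rw [Fintype.card_fin] at h1
    rw [numUpper] at hj
    refine absurd (lt_of_lt_of_le hj h1) ?_
    simp [Fintype.card_subtype]
  · rfl

/-- Both ranges of j can be enlarged to a common one: beyond the number of upper features there are
no increasing injections, and beyond the length of the input the term is zero by definition. The
last summand is the main term. -/
theorem kernel_eq_sum (ν : ℕ → PMF ℕ) (σ : ℝ) (Z D : Diagram) :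
    kernel ν σ Z D = ∑ j ∈ Finset.range Z.1, kernelTerm ν σ Z D j + kernelTerm ν σ Z D Z.1 := by
  have h : kernel ν σ Z D = ∑ j ∈ Finset.range (numUpper σ D.2 + 1), kernelTerm ν σ Z D j := rfl
  have h1 : ∀ a, numUpper σ D.2 + 1 ≤ a →
      kernel ν σ Z D = ∑ j ∈ Finset.range a, kernelTerm ν σ Z D j := fun a ha => by
    rw [h]
    refine Finset.sum_subset (Finset.range_subset_range.2 ha) fun j _ hj => ?_
    exact kernelTerm_eq_zero_of_numUpper_lt ν σ Z D (by simpa using hj)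
  rw [← Finset.sum_range_succ, h1 (max (numUpper σ D.2 + 1) (Z.1 + 1)) (le_max_left _ _)]
  symm
  refine Finset.sum_subset (Finset.range_subset_range.2 (le_max_right _ _)) fun j _ hj => ?_
  have : ¬ j ≤ Z.1 := by simpa [Nat.lt_succ_iff] using hj
  rw [kernelTerm, dif_neg this]

theorem kernelTerm_self_eq_upperPart (ν : ℕ → PMF ℕ) {σ : ℝ} (hσ : 0 < σ) {M N : ℕ}
    {ξ : Fin N → Feature} (hξ : ξ ∈ power wedge N) {D : Diagram} (hM : D.1 ≤ M)
    (hD : D.2 ∈ power wedge D.1) :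
    kernelTerm ν σ ⟨N, ξ⟩ D N = upperPart ν M σ ξ D := by
  classical
  rw [kernelTerm, dif_pos le_rfl, upperPart, if_pos hM, Finset.mul_sum]
  have hsub : ∑ e : Fin N → Fin D.1, coef ν σ e D.2 * ∏ k, gauss σ (D.2 (e k)) (ξ k) =
      ∑ e : Fin N → Fin D.1 with StrictMono e ∧ ∀ k, σ ≤ (D.2 (e k)).2 - (D.2 (e k)).1,
        coef ν σ e D.2 * ∏ k, gauss σ (D.2 (e k)) (ξ k) := by
    symm
    refine Finset.sum_filter_of_ne fun e _ he => ?_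
    by_contra hcon
    refine he ?_
    rw [coef, if_neg fun h => hcon ⟨h.1, h.2.2⟩, zero_mul]
  rw [hsub]
  -- Assignments into upper features correspond to increasing maps into all indices whose values are
  -- upper.
  refine Finset.sum_nbij (fun γ k => (γ k : Fin D.1)) (fun γ hγ => ?_) (fun γ _ γ' _ h => ?_)
    (fun e he => ?_) (fun γ hγ => ?_)
  · have hγ' : StrictMono γ := (Finset.mem_filter.1 hγ).2
    exact Finset.mem_filter.2 ⟨Finset.mem_univ _, fun a b hab => hγ' hab, fun k => (γ k).2⟩
  · funext k
    exact Subtype.ext (congrFun h k)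
  · have he' := (Finset.mem_filter.1 he).2
    exact ⟨fun k => ⟨e k, he'.2 k⟩, Finset.mem_coe.2 (Finset.mem_filter.2 ⟨Finset.mem_univ _,
      fun a b hab => he'.1 hab⟩), rfl⟩
  · have hγ' : StrictMono γ := (Finset.mem_filter.1 hγ).2
    have hemp : (Finset.univ.filter fun k : Fin N => N ≤ (k : ℕ)) = ∅ :=
      Finset.filter_false_of_mem fun k _ => not_le.2 k.2
    have hup : ∀ k, upperDensity σ (D.2 (γ k)) (ξ k) =
        gauss σ (D.2 (γ k)) (ξ k) / mass σ wedge (D.2 (γ k)) := fun k => by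
      rw [upperDensity, if_pos (hξ k), mass]
    rw [weight_eq hσ D.2 hγ', coef, if_pos ⟨fun a b hab => hγ' hab, hD, fun k => (γ k).2⟩]
    simp only [hemp, Finset.prod_empty, mul_one, Fin.castLE_rfl, id, hup, Nat.sub_self, amplitude,
      Finset.prod_div_distrib]
    ring

/-! ### The part of the kernel with lower inputs -/

/-- A bound for the lower density at distance at least `δ` above the diagonal. -/
def lowerBound (δ σ : ℝ) : ℝ := 1 / (Real.pi * σ ^ 2) * Real.exp (-δ ^ 2 / (4 * σ ^ 2))

theorem lowerDensity_nonneg (σ : ℝ) {m : ℕ} (η : Fin m → Feature) (x : Feature) :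
    0 ≤ lowerDensity σ η x := by
  unfold lowerDensity
  exact mul_nonneg (by positivity) (Finset.sum_nonneg fun _ _ => by positivity)

/-- The projected means lie on the diagonal, at distance at least δ/√2 from x, and the density is an
average over them. -/
theorem lowerDensity_le {δ σ : ℝ} (hσ : 0 < σ) (hδ : 0 ≤ δ) {m : ℕ} (η : Fin m → Feature)
    {x : Feature} (hx : δ ≤ x.2 - x.1) : lowerDensity σ η x ≤ lowerBound δ σ := by
  classical
  have h1 : ∀ a : ℝ, 1 / (Real.pi * σ ^ 2) *
      Real.exp (-((x.1 - a) ^ 2 + (x.2 - a) ^ 2) / (2 * σ ^ 2)) ≤ lowerBound δ σ := fun a => by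
    refine mul_le_mul_of_nonneg_left (Real.exp_le_exp.2 ?_) (by positivity)
    rw [div_le_div_iff₀ (by positivity) (by positivity)]
    have h2 : δ ^ 2 ≤ (x.2 - x.1) ^ 2 := pow_le_pow_left₀ hδ hx 2
    have h3 : (x.2 - x.1) ^ 2 ≤ 2 * ((x.1 - a) ^ 2 + (x.2 - a) ^ 2) := by
      nlinarith [sq_nonneg ((x.1 - a) + (x.2 - a))]
    have h4 := mul_le_mul_of_nonneg_right (h2.trans h3) (sq_nonneg σ)
    linarith
  have h0 : 0 ≤ lowerBound δ σ := by unfold lowerBound; positivity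
  unfold lowerDensity
  refine (mul_le_mul_of_nonneg_left (Finset.sum_le_sum fun i _ => h1 _) (by positivity)).trans ?_
  rw [Finset.sum_const, Finset.card_univ, nsmul_eq_mul, ← mul_assoc, one_div, numLower]
  refine mul_le_of_le_one_left h0 ?_
  -- An inequality only: without lower features the inverse is 0 by convention.
  convert inv_mul_le_one (a := ((Fintype.card (Lower σ η) : ℕ) : ℝ))

theorem upperDensity_nonneg (σ : ℝ) (c x : Feature) : 0 ≤ upperDensity σ c x := by
  unfold upperDensity
  split_ifs
  · exact div_nonneg (gauss_nonneg _ _ _) (mass_nonneg σ wedge c)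
  · exact le_rfl

theorem upperDensity_le {σ : ℝ} (hσ : 0 < σ) {c : Feature} (hc : c ∈ wedge) (x : Feature) :
    upperDensity σ c x ≤ 1 / (2 * Real.pi * σ ^ 2) / massBound := by
  have hb := massBound_pos
  unfold upperDensity
  split_ifs
  · exact div_le_div₀ (by positivity) (gauss_le _ _ _) hb (massBound_le_mass hσ hc)
  · positivity

theorem card_filter_le_val (N j : ℕ) :
    (Finset.univ.filter fun k : Fin N => j ≤ (k : ℕ)).card = N - j := by
  rw [Finset.card_filter, Fin.sum_univ_eq_sum_range (fun k => if j ≤ k then 1 else 0) N,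
    ← Finset.card_filter, ← Nat.card_Ico]
  congr 1
  ext k
  simp [and_comm]

/-- A bound for the part of the kernel with lower inputs. -/
def lowerError (M N : ℕ) (δ σ : ℝ) : ℝ := ∑ j ∈ Finset.range N,
  (((M : ℝ) + 1) * (1 / (2 * Real.pi * σ ^ 2) / massBound)) ^ j * lowerBound δ σ ^ (N - j)

theorem kernelTerm_nonneg (ν : ℕ → PMF ℕ) {σ : ℝ} (hσ : 0 < σ) (Z D : Diagram) (j : ℕ) :
    0 ≤ kernelTerm ν σ Z D j := by
  classical
  unfold kernelTerm
  split_ifs with h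
  · refine mul_nonneg ENNReal.toReal_nonneg (Finset.sum_nonneg fun γ hγ => ?_)
    exact mul_nonneg (mul_nonneg (weight_nonneg hσ _ (Finset.mem_filter.1 hγ).2)
      (Finset.prod_nonneg fun _ _ => upperDensity_nonneg _ _ _))
      (Finset.prod_nonneg fun _ _ => lowerDensity_nonneg _ _ _)
  · exact le_rfl

theorem kernelTerm_le (ν : ℕ → PMF ℕ) {δ σ : ℝ} (hσ : 0 < σ) (hδ : 0 ≤ δ) {M N : ℕ}
    {ξ : Fin N → Feature} (hξ : ∀ k, δ ≤ (ξ k).2 - (ξ k).1) {D : Diagram} (hM : D.1 ≤ M)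
    (hD : D.2 ∈ power wedge D.1) (j : ℕ) :
    kernelTerm ν σ ⟨N, ξ⟩ D j ≤
      (((M : ℝ) + 1) * (1 / (2 * Real.pi * σ ^ 2) / massBound)) ^ j *
        lowerBound δ σ ^ (N - j) := by
  classical
  have hb := massBound_pos
  have h0 : 0 ≤ lowerBound δ σ := by unfold lowerBound; positivity
  unfold kernelTerm
  split_ifs with h
  · have h1 : ∀ γ ∈ Finset.univ.filter (fun γ : Fin j → Upper σ D.2 => StrictMono γ),
        weight σ D.2 γ *
          (∏ k : Fin j, upperDensity σ (D.2 (γ k)) (ξ (Fin.castLE h k))) *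
          ∏ k ∈ Finset.univ.filter (fun k : Fin N => j ≤ (k : ℕ)), lowerDensity σ D.2 (ξ k) ≤
        (1 / (2 * Real.pi * σ ^ 2) / massBound) ^ j * lowerBound δ σ ^ (N - j) := fun γ hγ => by
      have hγ' := (Finset.mem_filter.1 hγ).2
      have hu : ∏ k : Fin j, upperDensity σ (D.2 (γ k)) (ξ (Fin.castLE h k)) ≤
          (1 / (2 * Real.pi * σ ^ 2) / massBound) ^ j :=
        (Finset.prod_le_prod (fun _ _ => upperDensity_nonneg _ _ _)
          fun k _ => upperDensity_le hσ (hD _) _).trans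
            (by rw [Finset.prod_const, Finset.card_univ, Fintype.card_fin])
      have hl : ∏ k ∈ Finset.univ.filter (fun k : Fin N => j ≤ (k : ℕ)), lowerDensity σ D.2 (ξ k) ≤
          lowerBound δ σ ^ (N - j) := by
        refine (Finset.prod_le_prod (fun _ _ => lowerDensity_nonneg _ _ _)
          fun k _ => lowerDensity_le hσ hδ D.2 (hξ k)).trans ?_
        rw [Finset.prod_const, card_filter_le_val]
      have hp : 0 ≤ ∏ k : Fin j, upperDensity σ (D.2 (γ k)) (ξ (Fin.castLE h k)) :=
        Finset.prod_nonneg fun _ _ => upperDensity_nonneg _ _ _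
      exact mul_le_mul ((mul_le_of_le_one_left hp (weight_le_one hσ _ hγ')).trans hu) hl
        (Finset.prod_nonneg fun _ _ => lowerDensity_nonneg _ _ _) (by positivity)
    have hcard : ((Finset.univ.filter fun γ : Fin j → Upper σ D.2 => StrictMono γ).card : ℝ) ≤
        ((M : ℝ) + 1) ^ j := by
      have h2 : Fintype.card (Upper σ D.2) ≤ M + 1 := by
        refine (Fintype.card_subtype_le _).trans ?_
        rw [Fintype.card_fin]; omega
      have h3 : (Finset.univ.filter fun γ : Fin j → Upper σ D.2 => StrictMono γ).card ≤
          (M + 1) ^ j := by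
        refine (Finset.card_filter_le _ _).trans ?_
        rw [Finset.card_univ, Fintype.card_fun, Fintype.card_fin]
        exact Nat.pow_le_pow_left h2 j
      exact_mod_cast h3
    refine (mul_le_of_le_one_left (Finset.sum_nonneg fun γ hγ =>
      mul_nonneg (mul_nonneg (weight_nonneg hσ _ (Finset.mem_filter.1 hγ).2)
      (Finset.prod_nonneg fun _ _ => upperDensity_nonneg _ _ _))
      (Finset.prod_nonneg fun _ _ => lowerDensity_nonneg _ _ _)) (pmf_toReal_le_one _ _)).trans ?_
    refine (Finset.sum_le_sum h1).trans ?_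
    rw [Finset.sum_const, nsmul_eq_mul, mul_pow, mul_assoc (((M : ℝ) + 1) ^ j)]
    exact mul_le_mul_of_nonneg_right hcard (by positivity)
  · positivity

theorem abs_kernel_sub_upperPart_le (ν : ℕ → PMF ℕ) {δ σ : ℝ} (hσ : 0 < σ) (hδ : 0 ≤ δ) {M N : ℕ}
    {ξ : Fin N → Feature} (hξW : ξ ∈ power wedge N) (hξ : ∀ k, δ ≤ (ξ k).2 - (ξ k).1) {D : Diagram}
    (hM : D.1 ≤ M) (hD : D.2 ∈ power wedge D.1) :
    |kernel ν σ ⟨N, ξ⟩ D - upperPart ν M σ ξ D| ≤ lowerError M N δ σ := by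
  rw [kernel_eq_sum]
  simp only
  rw [kernelTerm_self_eq_upperPart ν hσ hξW hM hD, add_sub_cancel_right,
    abs_of_nonneg (Finset.sum_nonneg fun j _ => kernelTerm_nonneg ν hσ _ D j)]
  exact Finset.sum_le_sum fun j _ => kernelTerm_le ν hσ hδ hξ hM hD j

theorem tendsto_lowerError (M N : ℕ) {δ : ℝ} (hδ : 0 < δ) :
    Tendsto (lowerError M N δ) (𝓝[>] 0) (𝓝 0) := by
  have hb := massBound_pos
  suffices h : ∀ j ∈ Finset.range N, Tendsto (fun σ : ℝ =>
      (((M : ℝ) + 1) * (1 / (2 * Real.pi * σ ^ 2) / massBound)) ^ j * lowerBound δ σ ^ (N - j))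
      (𝓝[>] 0) (𝓝 0) by
    have h' := tendsto_finsetSum _ h
    rwa [Finset.sum_const_zero] at h'
  refine fun j hj => ?_
  have hjN : j < N := Finset.mem_range.1 hj
  -- The N - j lower factors contribute exp(-c/σ²), with c > 0 because j < N. The rest is a constant
  -- times σ^(-2N), so with y = c/σ² the limit is that of y^N exp(-y).
  set c : ℝ := (N - j : ℕ) * (δ ^ 2 / 4) with hc
  have hc0 : 0 < c := by
    have : (0 : ℝ) < (N - j : ℕ) := Nat.cast_pos.2 (by omega)
    positivity
  have hy : Tendsto (fun σ : ℝ => c * (σ⁻¹) ^ 2) (𝓝[>] 0) atTop :=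
    ((tendsto_pow_atTop two_ne_zero).comp tendsto_inv_nhdsGT_zero).const_mul_atTop hc0
  have h := ((Real.tendsto_pow_mul_exp_neg_atTop_nhds_zero N).comp hy).const_mul
    ((((M : ℝ) + 1) * (1 / (2 * Real.pi) / massBound)) ^ j * (1 / Real.pi) ^ (N - j) / c ^ N)
  rw [mul_zero] at h
  refine h.congr' ?_
  filter_upwards [self_mem_nhdsWithin] with σ (hσ : 0 < σ)
  have e1 : Real.exp (-δ ^ 2 / (4 * σ ^ 2)) ^ (N - j) = Real.exp (-(c * (σ⁻¹) ^ 2)) := by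
    rw [← Real.exp_nat_mul, hc]
    congr 1
    field_simp
  have e2 : ((σ⁻¹) ^ 2) ^ N = ((σ⁻¹) ^ 2) ^ j * ((σ⁻¹) ^ 2) ^ (N - j) := by
    rw [← pow_add]; congr 1; omega
  have e3 : ((M : ℝ) + 1) * (1 / (2 * Real.pi * σ ^ 2) / massBound) =
      ((M : ℝ) + 1) * (1 / (2 * Real.pi) / massBound) * (σ⁻¹) ^ 2 := by field_simp
  have e4 : 1 / (Real.pi * σ ^ 2) = 1 / Real.pi * (σ⁻¹) ^ 2 := by field_simp
  simp only [Function.comp_apply]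
  rw [lowerBound, mul_pow (1 / (Real.pi * σ ^ 2)), e1, e3, e4, mul_pow _ ((σ⁻¹) ^ 2) j,
    mul_pow _ ((σ⁻¹) ^ 2) (N - j), mul_pow c, e2]
  field_simp

/-! ### Decay of the local densities -/

/-- With S the squared norm, ∏ (1 + b_i²) ≤ (1 + S)^m. For S ≤ 1 this is bounded and (A2) suffices;
for S ≥ 1 it is at most (2S)^m, which the decay S^(-m) in (A3) exactly compensates. The product form
is what lets the integrals factor over the features. -/
theorem exists_le_mul_prod {f : (N : ℕ) → (Fin N → Feature) → ℝ} {M : ℕ}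
    (hA2 : BoundedLocalDensities f M) (hA3 : PolynomialDecay f M) {m : ℕ} (hm : m ≤ M) :
    ∃ C : ℝ, 0 < C ∧ ∀ η ∈ power wedge m, f m η ≤ C * ∏ i, (1 + (η i).1 ^ 2)⁻¹ := by
  -- (A2) and (A3) do not cover the empty diagram, but there f takes a single value.
  rcases Nat.eq_zero_or_pos m with rfl | hm0
  · refine ⟨max 1 (f 0 0), by positivity, fun η _ => ?_⟩
    rw [Subsingleton.elim η 0]
    simp
  obtain ⟨C₂, h₂⟩ := hA2 m hm0 hm
  obtain ⟨C₃, hC₃, h₃⟩ := hA3 m hm0 hm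
  refine ⟨2 ^ m * max (max 1 C₂) C₃, by positivity, fun η hη => ?_⟩
  set C := max (max 1 C₂) C₃ with hC
  have hC0 : 0 < C := by positivity
  set S := ∑ i, ((η i).1 ^ 2 + (η i).2 ^ 2) with hS
  have hS0 : 0 ≤ S := Finset.sum_nonneg fun i _ => by positivity
  have hprod : ∏ i, (1 + (η i).1 ^ 2) ≤ (1 + S) ^ m := by
    refine (Finset.prod_le_prod (g := fun _ => 1 + S) (fun i _ => by positivity)
      fun i _ => ?_).trans (by simp)
    have := Finset.single_le_sum (f := fun i => (η i).1 ^ 2 + (η i).2 ^ 2)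
      (fun i _ => by positivity) (Finset.mem_univ i)
    nlinarith [sq_nonneg (η i).2]
  have hpos : 0 < ∏ i, (1 + (η i).1 ^ 2) := Finset.prod_pos fun i _ => by positivity
  rw [Finset.prod_inv_distrib, ← div_eq_mul_inv, le_div_iff₀ hpos]
  rcases le_total S 1 with h | h
  · calc f m η * ∏ i, (1 + (η i).1 ^ 2) ≤ C * ∏ i, (1 + (η i).1 ^ 2) :=
          mul_le_mul_of_nonneg_right ((h₂ η hη).trans ((le_max_right _ _).trans (le_max_left _ _)))
            hpos.le
      _ ≤ C * 2 ^ m := mul_le_mul_of_nonneg_left (hprod.trans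
          (pow_le_pow_left₀ (by positivity) (by linarith) m)) hC0.le
      _ = _ := mul_comm _ _
  · have hS1 : 0 < S := by linarith
    calc f m η * ∏ i, (1 + (η i).1 ^ 2) ≤ C / S ^ m * ∏ i, (1 + (η i).1 ^ 2) := by
          refine mul_le_mul_of_nonneg_right ((h₃ η hη).trans ?_) hpos.le
          gcongr
          exact le_max_right _ _
      _ ≤ C / S ^ m * (2 * S) ^ m := mul_le_mul_of_nonneg_left (hprod.trans
          (pow_le_pow_left₀ (by positivity) (by linarith) m)) (by positivity)
      _ = _ := by rw [mul_pow]; field_simp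

/-! ### Integrals with respect to the law of the diagram -/

theorem measurable_sigmaMk (m : ℕ) :
    Measurable (@Sigma.mk ℕ (fun N => Fin N → Feature) m) := fun _ hs =>
  MeasurableSpace.measurableSet_iInf.1 hs m

theorem integral_diagramLaw {f : (N : ℕ) → (Fin N → Feature) → ℝ} (hf : IsGlobalPdf f)
    {g : Diagram → ℝ} (hg : Measurable g) (hint : Integrable g (diagramLaw f)) {M : ℕ}
    (hgM : ∀ m, M < m → ∀ η : Fin m → Feature, g ⟨m, η⟩ = 0) :
    ∫ D, g D ∂diagramLaw f =
      ∑ m ∈ Finset.range (M + 1), ∫ η in power wedge m, f m η * g ⟨m, η⟩ := by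
  have hterm : ∀ m, ∫ D, g D ∂(((volume.restrict (power wedge m)).withDensity
      fun ξ => ENNReal.ofReal (f m ξ)).map (Sigma.mk m)) =
      ∫ η in power wedge m, f m η * g ⟨m, η⟩ := fun m => by
    rw [integral_map (measurable_sigmaMk m).aemeasurable hg.aestronglyMeasurable,
      integral_withDensity_eq_integral_toReal_smul₀ (hf.aemeasurable m).ennreal_ofReal
        (ae_of_all _ fun _ => ENNReal.ofReal_lt_top)]
    refine setIntegral_congr_fun (measurableSet_power measurableSet_wedge m) fun η hη => ?_
    simp only [smul_eq_mul]
    rw [ENNReal.toReal_ofReal (hf.nonneg m η hη)]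
  have hsum : ∫ D, g D ∂diagramLaw f = ∑' m, ∫ D, g D ∂(((volume.restrict
      (power wedge m)).withDensity fun ξ => ENNReal.ofReal (f m ξ)).map (Sigma.mk m)) :=
    integral_sum_measure hint
  rw [hsum, tsum_congr hterm]
  refine tsum_eq_sum fun m hm => ?_
  have hm' : M < m := by simpa [Nat.lt_succ_iff] using hm
  simp [hgM m hm']

/-! ### Integrals over the features that are not hit -/

/-- A majorant of `miss` on the wedge with a decaying weight. -/
def missMajorant (σ : ℝ) (x : Feature) : ℝ :=
  32 * (1 + ((x.2 - x.1) / σ) ^ 2)⁻¹ * (1 + x.1 ^ 2)⁻¹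

theorem missMajorant_nonneg (σ : ℝ) (x : Feature) : 0 ≤ missMajorant σ x := by
  unfold missMajorant; positivity

/-- For upper features use the Chebyshev bound and σ ≤ d - b, which gives 16 · 2 = 32. For lower
features (d - b)/σ ≤ 1, so the majorant's first two factors exceed 1. -/
theorem miss_mul_le_missMajorant {σ : ℝ} (hσ : 0 < σ) {x : Feature} (hx : x ∈ wedge) :
    miss σ x * (1 + x.1 ^ 2)⁻¹ ≤ missMajorant σ x := by
  refine mul_le_mul_of_nonneg_right ?_ (by positivity)
  have hg : 0 < x.2 - x.1 := sub_pos.2 hx.2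
  rw [← div_eq_mul_inv, le_div_iff₀ (by positivity)]
  unfold miss
  split_ifs with h
  · have h1 := one_sub_presence_le hσ hx.2
    have h2 : σ ^ 2 ≤ (x.2 - x.1) ^ 2 := pow_le_pow_left₀ hσ.le h 2
    calc _ ≤ 16 * σ ^ 2 / (x.2 - x.1) ^ 2 * (1 + ((x.2 - x.1) / σ) ^ 2) :=
          mul_le_mul_of_nonneg_right h1 (by positivity)
      _ = 16 * ((σ ^ 2 + (x.2 - x.1) ^ 2) / (x.2 - x.1) ^ 2) := by field_simp
      _ ≤ 16 * 2 := by
          refine mul_le_mul_of_nonneg_left ?_ (by norm_num)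
          rw [div_le_iff₀ (by positivity)]
          linarith
      _ = 32 := by norm_num
  · have h1 : (x.2 - x.1) / σ ≤ 1 := by rw [div_le_one hσ]; linarith
    have h2 : ((x.2 - x.1) / σ) ^ 2 ≤ 1 := pow_le_one₀ (by positivity) h1
    linarith

/-- The measure preserving shear (b, d) ↦ (b, d - b) separates the variables. The gap contributes
πσ, the birth coordinate π. -/
theorem integrable_missMajorant_and_integral {σ : ℝ} (hσ : 0 < σ) :
    Integrable (missMajorant σ) ∧ ∫ x, missMajorant σ x = 32 * Real.pi ^ 2 * σ := by
  have h1 : Integrable fun t : ℝ => (1 + (t / σ) ^ 2)⁻¹ := integrable_inv_one_add_sq.comp_div hσ.ne'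
  have h2 : ∫ t : ℝ, (1 + (t / σ) ^ 2)⁻¹ = σ * Real.pi := by
    rw [Measure.integral_comp_div (fun t : ℝ => (1 + t ^ 2)⁻¹), integral_univ_inv_one_add_sq,
      abs_of_pos hσ, smul_eq_mul]
  have h3 : Integrable (fun z : ℝ × ℝ => (1 + z.1 ^ 2)⁻¹ * (1 + (z.2 / σ) ^ 2)⁻¹)
      (volume.prod volume) := integrable_inv_one_add_sq.mul_prod h1
  have hmp : MeasurePreserving (fun z : ℝ × ℝ => (z.1, -z.1 + z.2)) (volume.prod volume)
      (volume.prod volume) := measurePreserving_prod_neg_add volume volume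
  have he : (missMajorant σ) = fun x => 32 * (fun z : ℝ × ℝ => (1 + z.1 ^ 2)⁻¹ *
      (1 + (z.2 / σ) ^ 2)⁻¹) (x.1, -x.1 + x.2) := by
    ext x
    simp only [missMajorant]
    rw [neg_add_eq_sub]
    ring
  have hemb : MeasurableEmbedding (fun z : ℝ × ℝ => (z.1, -z.1 + z.2)) :=
    ((MeasurableEquiv.shearAddRight ℝ).symm).measurableEmbedding
  rw [he, Measure.volume_eq_prod]
  constructor
  · exact ((hmp.integrable_comp_emb hemb).2 h3).const_mul 32
  · rw [integral_const_mul, hmp.integral_comp hemb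
      (fun z : ℝ × ℝ => (1 + z.1 ^ 2)⁻¹ * (1 + (z.2 / σ) ^ 2)⁻¹),
      integral_prod_mul (fun t : ℝ => (1 + t ^ 2)⁻¹) (fun t : ℝ => (1 + (t / σ) ^ 2)⁻¹), h2,
      integral_univ_inv_one_add_sq]
    ring

/-! ### Bounds for the expectation of the kernel on each layer -/

theorem prod_extend {ι κ : Type*} [Fintype ι] [Fintype κ] {e : ι → κ}
    [DecidablePred fun i => i ∉ Set.range e] (he : Function.Injective e) {β : Type*} (a : ι → β) (b : κ → β) (F : β → κ → ℝ) :
    ∏ i, F (Function.extend e a b i) i =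
      (∏ k, F (a k) (e k)) * ∏ i with i ∉ Set.range e, F (b i) i := by
  classical
  rw [← Finset.prod_filter_mul_prod_filter_not Finset.univ (fun i => i ∈ Set.range e),
    prod_mem_range he fun i => F (Function.extend e a b i) i]
  congr 1
  · exact Finset.prod_congr rfl fun k _ => by rw [he.extend_apply]
  · refine Finset.prod_congr rfl fun i hi => ?_
    rw [Function.extend_apply' _ _ _ fun ⟨k, hk⟩ => (Finset.mem_filter.1 hi).2 ⟨k, hk⟩]

theorem card_notMem_range {N m : ℕ} {e : Fin N → Fin m}
    [DecidablePred fun i => i ∉ Set.range e] (he : Function.Injective e) :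
    (Finset.univ.filter fun i => i ∉ Set.range e).card = m - N := by
  classical
  have h : (Finset.univ.filter fun i => i ∉ Set.range e) = (Finset.univ.image e)ᶜ := by
    ext; simp
  rw [h, Finset.card_compl, Finset.card_image_of_injective _ he]
  simp

/-- The factors of a majorant of the integrand that belongs to an assignment `e` of the inputs. -/
def layerMajorant (σ : ℝ) {N m : ℕ} (e : Fin N → Fin m) (ξ : Fin N → Feature) :
    Fin m → Feature → ℝ :=
  Function.extend e (fun k => gauss σ (ξ k)) fun _ => missMajorant σ

theorem integrable_prod_layerMajorant {σ : ℝ} (hσ : 0 < σ) {N m : ℕ} {e : Fin N → Fin m}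
    (he : Function.Injective e) (ξ : Fin N → Feature) :
    Integrable fun η : Fin m → Feature => ∏ i, layerMajorant σ e ξ i (η i) := by
  refine Integrable.fintype_prod fun i => ?_
  unfold layerMajorant
  by_cases h : ∃ k, e k = i
  · obtain ⟨k, rfl⟩ := h
    rw [he.extend_apply]
    exact integrable_gauss hσ _
  · rw [Function.extend_apply' _ _ _ h]
    exact (integrable_missMajorant_and_integral hσ).1

/-- By Fubini, each feature that is hit integrates to 1 and each of the m - N others to 32π²σ. -/
theorem integral_prod_layerMajorant {σ : ℝ} (hσ : 0 < σ) {N m : ℕ} {e : Fin N → Fin m}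
    (he : Function.Injective e) (ξ : Fin N → Feature) :
    ∫ η : Fin m → Feature, ∏ i, layerMajorant σ e ξ i (η i) =
      (32 * Real.pi ^ 2 * σ) ^ (m - N) := by
  classical
  rw [integral_fintype_prod_volume_eq_prod]
  unfold layerMajorant
  rw [prod_extend he (fun k => gauss σ (ξ k)) (fun _ => missMajorant σ) fun h _ => ∫ x, h x]
  simp only [integral_gauss hσ, (integrable_missMajorant_and_integral hσ).2, Finset.prod_const_one,
    one_mul, Finset.prod_const, card_notMem_range he]

/-- Here y stands for the local density at η. The weights (1 + b²)⁻¹ of the features that are hit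
are dropped, the others are joined to `miss`. By symmetry the Gaussians become densities in the
center with mean at the input. -/
theorem mul_coef_mul_prod_gauss_le (ν : ℕ → PMF ℕ) {σ : ℝ} (hσ : 0 < σ) {N m : ℕ}
    {e : Fin N → Fin m} (he : Function.Injective e) (ξ : Fin N → Feature) {η : Fin m → Feature}
    (hη : η ∈ power wedge m) {y C : ℝ} (hy0 : 0 ≤ y) (hC : 0 ≤ C)
    (hy : y ≤ C * ∏ i, (1 + (η i).1 ^ 2)⁻¹) :
    y * (coef ν σ e η * ∏ k, gauss σ (η (e k)) (ξ k)) ≤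
      C * (1 / massBound) ^ N * ∏ i, layerMajorant σ e ξ i (η i) := by
  classical
  have hb := massBound_pos
  have h1 : y ≤ C * ∏ i with i ∉ Set.range e, (1 + (η i).1 ^ 2)⁻¹ := by
    refine hy.trans (mul_le_mul_of_nonneg_left ?_ hC)
    rw [← Finset.prod_filter_mul_prod_filter_not Finset.univ (fun i => i ∈ Set.range e)]
    refine mul_le_of_le_one_left (Finset.prod_nonneg fun _ _ => by positivity)
      (Finset.prod_le_one (fun _ _ => by positivity) fun i _ => ?_)
    exact inv_le_one_of_one_le₀ (le_add_of_nonneg_right (sq_nonneg _))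
  have h2 := coef_le_mul_prod_miss ν hσ e η
  have h3 : (∏ i with i ∉ Set.range e, (1 + (η i).1 ^ 2)⁻¹) *
      ∏ i with i ∉ Set.range e, miss σ (η i) ≤
      ∏ i with i ∉ Set.range e, missMajorant σ (η i) := by
    rw [← Finset.prod_mul_distrib]
    refine Finset.prod_le_prod (fun i _ => mul_nonneg (by positivity) (miss_nonneg hσ _))
      fun i _ => ?_
    rw [mul_comm]
    exact miss_mul_le_missMajorant hσ (hη i)
  have h4 : ∏ k, gauss σ (η (e k)) (ξ k) = ∏ k, gauss σ (ξ k) (η (e k)) :=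
    Finset.prod_congr rfl fun k _ => gauss_comm _ _ _
  have h5 : 0 ≤ ∏ k, gauss σ (ξ k) (η (e k)) := Finset.prod_nonneg fun _ _ => gauss_nonneg _ _ _
  unfold layerMajorant
  rw [prod_extend he (fun k => gauss σ (ξ k)) (fun _ => missMajorant σ) fun h i => h (η i), h4,
    ← mul_assoc]
  have h6 := mul_le_mul h1 h2 (coef_nonneg ν hσ e η) (hy0.trans h1)
  have h7 := mul_le_mul_of_nonneg_left h3 (by positivity : 0 ≤ C * (1 / massBound) ^ N)
  calc _ ≤ (C * (∏ i with i ∉ Set.range e, (1 + (η i).1 ^ 2)⁻¹) * ((1 / massBound) ^ N *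
        ∏ i with i ∉ Set.range e, miss σ (η i))) * ∏ k, gauss σ (ξ k) (η (e k)) :=
        mul_le_mul_of_nonneg_right h6 h5
    _ = (C * (1 / massBound) ^ N * ((∏ i with i ∉ Set.range e, (1 + (η i).1 ^ 2)⁻¹) *
        ∏ i with i ∉ Set.range e, miss σ (η i))) * ∏ k, gauss σ (ξ k) (η (e k)) := by ring
    _ ≤ (C * (1 / massBound) ^ N * ∏ i with i ∉ Set.range e, missMajorant σ (η i)) *
        ∏ k, gauss σ (ξ k) (η (e k)) := mul_le_mul_of_nonneg_right h7 h5
    _ = _ := by ring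

/-- The contribution of centers with `m` features to the expectation of `upperPart`. -/
def layerMean (f : (N : ℕ) → (Fin N → Feature) → ℝ) (ν : ℕ → PMF ℕ) (M m : ℕ) (σ : ℝ) {N : ℕ}
    (ξ : Fin N → Feature) : ℝ :=
  ∫ η in power wedge m, f m η * upperPart ν M σ ξ ⟨m, η⟩

theorem upperPart_eq_zero_of_lt (ν : ℕ → PMF ℕ) (M : ℕ) (σ : ℝ) {N : ℕ} (ξ : Fin N → Feature)
    (D : Diagram) (h : D.1 < N) : upperPart ν M σ ξ D = 0 := by
  unfold upperPart
  split_ifs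
  · refine Finset.sum_eq_zero fun e _ => ?_
    rw [coef, if_neg, zero_mul]
    intro he
    have := Fintype.card_le_of_injective e he.1.injective
    simp only [Fintype.card_fin] at this
    omega
  · rfl

theorem layerMean_nonneg {f : (N : ℕ) → (Fin N → Feature) → ℝ} (hf : IsGlobalPdf f)
    (ν : ℕ → PMF ℕ) (M m : ℕ) {σ : ℝ} (hσ : 0 < σ) {N : ℕ} (ξ : Fin N → Feature) :
    0 ≤ layerMean f ν M m σ ξ := by
  unfold layerMean
  refine setIntegral_nonneg (measurableSet_power measurableSet_wedge m) fun η hη => ?_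
  exact mul_nonneg (hf.nonneg m η hη) (upperPart_nonneg ν M hσ ξ ⟨m, η⟩)

/-- A majorant of the integrand of `layerMean`. -/
def layerSum (σ : ℝ) (m : ℕ) {N : ℕ} (ξ : Fin N → Feature) (η : Fin m → Feature) : ℝ :=
  ∑ e : {e : Fin N → Fin m // Function.Injective e}, ∏ i, layerMajorant σ e.1 ξ i (η i)

theorem layerSum_nonneg (σ : ℝ) (m : ℕ) {N : ℕ} (ξ : Fin N → Feature) (η : Fin m → Feature) :
    0 ≤ layerSum σ m ξ η := by
  unfold layerSum
  refine Finset.sum_nonneg fun e _ => Finset.prod_nonneg fun i _ => ?_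
  unfold layerMajorant
  by_cases h : ∃ k, e.1 k = i
  · obtain ⟨k, rfl⟩ := h
    rw [e.2.extend_apply]
    exact gauss_nonneg _ _ _
  · rw [Function.extend_apply' _ _ _ h]
    exact missMajorant_nonneg _ _

theorem integrable_layerSum {σ : ℝ} (hσ : 0 < σ) (m : ℕ) {N : ℕ} (ξ : Fin N → Feature) :
    Integrable (layerSum σ m ξ) :=
  integrable_finsetSum _ fun e _ => integrable_prod_layerMajorant hσ e.2 ξ

theorem integral_layerSum_le {σ : ℝ} (hσ : 0 < σ) {m M : ℕ} (hm : m ≤ M) {N : ℕ}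
    (ξ : Fin N → Feature) :
    ∫ η, layerSum σ m ξ η ≤ ((M : ℝ) + 1) ^ N * (32 * Real.pi ^ 2 * σ) ^ (m - N) := by
  unfold layerSum
  rw [integral_finsetSum _ fun e _ => integrable_prod_layerMajorant hσ e.2 ξ]
  rw [Finset.sum_congr rfl fun e _ => integral_prod_layerMajorant hσ e.2 ξ, Finset.sum_const,
    nsmul_eq_mul]
  refine mul_le_mul_of_nonneg_right ?_ (by positivity)
  refine le_trans ?_ (card_fin_fun_le (N := N) hm)
  rw [Finset.card_univ]
  exact_mod_cast Fintype.card_subtype_le _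

theorem mul_upperPart_le (ν : ℕ → PMF ℕ) {M m : ℕ} (hm : m ≤ M) {σ : ℝ} (hσ : 0 < σ) {N : ℕ}
    (ξ : Fin N → Feature) {η : Fin m → Feature} (hη : η ∈ power wedge m) {y C : ℝ} (hy0 : 0 ≤ y)
    (hC : 0 ≤ C) (hy : y ≤ C * ∏ i, (1 + (η i).1 ^ 2)⁻¹) :
    y * upperPart ν M σ ξ ⟨m, η⟩ ≤ C * (1 / massBound) ^ N * layerSum σ m ξ η := by
  have hb := massBound_pos
  have e1 : upperPart ν M σ ξ ⟨m, η⟩ =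
      ∑ e : Fin N → Fin m, coef ν σ e η * ∏ k, gauss σ (η (e k)) (ξ k) := by
    rw [upperPart, if_pos hm]
  have e2 : ∑ e : Fin N → Fin m, coef ν σ e η * ∏ k, gauss σ (η (e k)) (ξ k) =
      ∑ e : {e : Fin N → Fin m // Function.Injective e},
        coef ν σ e.1 η * ∏ k, gauss σ (η (e.1 k)) (ξ k) := by
    classical
    rw [← Finset.sum_subtype (Finset.univ.filter Function.Injective) (by simp)
      fun e : Fin N → Fin m => coef ν σ e η * ∏ k, gauss σ (η (e k)) (ξ k)]
    symm
    refine Finset.sum_filter_of_ne fun e _ he => ?_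
    by_contra hcon
    refine he ?_
    rw [coef, if_neg fun h => hcon h.1.injective, zero_mul]
  rw [e1, e2, layerSum, Finset.mul_sum, Finset.mul_sum]
  exact Finset.sum_le_sum fun e _ => mul_coef_mul_prod_gauss_le ν hσ e.2 ξ hη hy0 hC hy

/-- For m > N this is decay of order σ^(m-N). For m ≤ N the truncated exponent is 0 and the estimate
is plain boundedness. Both are uniform in ξ. -/
theorem layerMean_le {f : (N : ℕ) → (Fin N → Feature) → ℝ} (hf : IsGlobalPdf f)
    (ν : ℕ → PMF ℕ) {M m : ℕ} (hm : m ≤ M) {σ : ℝ} (hσ : 0 < σ) {N : ℕ} (ξ : Fin N → Feature)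
    {C : ℝ} (hC : 0 ≤ C) (hfC : ∀ η ∈ power wedge m, f m η ≤ C * ∏ i, (1 + (η i).1 ^ 2)⁻¹) :
    layerMean f ν M m σ ξ ≤
      C * (1 / massBound) ^ N * (((M : ℝ) + 1) ^ N * (32 * Real.pi ^ 2 * σ) ^ (m - N)) := by
  have hb := massBound_pos
  have hW := measurableSet_power measurableSet_wedge m
  have hint := (integrable_layerSum hσ m ξ).const_mul (C * (1 / massBound) ^ N)
  calc layerMean f ν M m σ ξ ≤ ∫ η in power wedge m, C * (1 / massBound) ^ N * layerSum σ m ξ η := by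
        refine integral_mono_of_nonneg ?_ hint.integrableOn ?_
        · filter_upwards [ae_restrict_mem hW] with η hη
          exact mul_nonneg (hf.nonneg m η hη) (upperPart_nonneg ν M hσ ξ ⟨m, η⟩)
        · filter_upwards [ae_restrict_mem hW] with η hη
          exact mul_upperPart_le ν hm hσ ξ hη (hf.nonneg m η hη) hC (hfC η hη)
    _ ≤ ∫ η, C * (1 / massBound) ^ N * layerSum σ m ξ η :=
        setIntegral_le_integral hint (ae_of_all _ fun η =>
          mul_nonneg (by positivity) (layerSum_nonneg _ _ _ _))
    _ ≤ _ := by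
        rw [integral_const_mul]
        exact mul_le_mul_of_nonneg_left (integral_layerSum_le hσ hm ξ) (by positivity)

/-! ### The main layer -/

/-- The amplitude of the Gaussian centered at `x`, cut off on the lower features. -/
def cutAmplitude (σ : ℝ) (x : Feature) : ℝ := if σ ≤ x.2 - x.1 then amplitude σ x else 0

theorem measurable_cutAmplitude (σ : ℝ) : Measurable (cutAmplitude σ) :=
  Measurable.ite (measurableSet_le measurable_const (measurable_snd.sub measurable_fst))
    (measurable_amplitude σ) measurable_const

theorem cutAmplitude_nonneg (σ : ℝ) (x : Feature) : 0 ≤ cutAmplitude σ x := by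
  unfold cutAmplitude
  split_ifs
  · exact amplitude_nonneg σ x
  · exact le_rfl

theorem cutAmplitude_le {σ : ℝ} (hσ : 0 < σ) {x : Feature} (hx : x ∈ wedge) :
    cutAmplitude σ x ≤ 1 / massBound := by
  have hb := massBound_pos
  unfold cutAmplitude
  split_ifs
  · exact amplitude_le hσ hx
  · positivity

/-- The half plane and the wedge are neighbourhoods of x, so both masses tend to 1; the cut-off is
inactive once σ is below half the gap of x. -/
theorem tendsto_cutAmplitude {x : Feature} (hx : x ∈ openWedge) :
    Tendsto (fun p : ℝ × Feature => cutAmplitude p.1 p.2) (𝓝[>] 0 ×ˢ 𝓝 x) (𝓝 1) := by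
  have hO : openWedge ∈ 𝓝 x := isOpen_openWedge.mem_nhds hx
  have h1 := tendsto_mass measurableSet_halfPlane (mem_of_superset hO fun y hy => hy.2)
  have h2 := tendsto_mass measurableSet_wedge (mem_of_superset hO openWedge_subset_wedge)
  have h3 := h1.div h2 one_ne_zero
  rw [div_one] at h3
  refine h3.congr' ?_
  have hg : 0 < x.2 - x.1 := sub_pos.2 hx.2
  have h4 : ∀ᶠ p : ℝ × Feature in 𝓝[>] 0 ×ˢ 𝓝 x, p.1 < (x.2 - x.1) / 2 :=
    ((gt_mem_nhds (half_pos hg)).filter_mono nhdsWithin_le_nhds).prod_inl _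
  have h5 : ∀ᶠ p : ℝ × Feature in 𝓝[>] 0 ×ˢ 𝓝 x, (x.2 - x.1) / 2 < p.2.2 - p.2.1 := by
    refine Eventually.prod_inr (p := fun y : Feature => (x.2 - x.1) / 2 < y.2 - y.1) ?_ _
    exact (continuous_snd.sub continuous_fst).continuousAt.eventually (lt_mem_nhds (half_lt_self hg))
  filter_upwards [h4, h5] with p h6 h7
  rw [cutAmplitude, if_pos (h6.trans h7).le]
  rfl

/-- For ℓ = 0 the support condition excludes every k ≥ 1. -/
theorem lowerCardinality_zero {ν : ℕ → PMF ℕ} (hν : IsLowerCardinality ν) : ν 0 0 = 1 := by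
  obtain ⟨c, _, h⟩ := hν.2
  have h1 := (ν 0).tsum_coe
  rwa [tsum_eq_single 0 fun k hk => h 0 k (by simpa using Nat.pos_of_ne_zero hk)] at h1

/-- The increasing enumeration of a finite set is unique. Hence the layer m = N carries a single
assignment. -/
theorem strictMono_fin_iff {N : ℕ} (e : Fin N → Fin N) : StrictMono e ↔ e = id := by
  constructor
  · intro h
    have h1 : Finset.univ.orderEmbOfFin (Finset.card_fin N) = OrderEmbedding.ofStrictMono e h :=
      (Finset.orderEmbOfFin_unique' _ fun _ => Finset.mem_univ _).symm
    have h2 : Finset.univ.orderEmbOfFin (Finset.card_fin N) =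
        OrderEmbedding.ofStrictMono id strictMono_id :=
      (Finset.orderEmbOfFin_unique' _ fun _ => Finset.mem_univ _).symm
    exact congrArg DFunLike.coe (h1.symm.trans h2)
  · rintro rfl
    exact strictMono_id

/-- If all features are upper, none is missed and ν contributes ν 0 0 = 1; if one is lower, both
sides vanish. -/
theorem upperPart_self {ν : ℕ → PMF ℕ} (hν : IsLowerCardinality ν) {M N : ℕ} (hN : N ≤ M) (σ : ℝ)
    (ξ : Fin N → Feature) {η : Fin N → Feature} (hη : η ∈ power wedge N) :
    upperPart ν M σ ξ ⟨N, η⟩ = ∏ k, cutAmplitude σ (η k) * gauss σ (ξ k) (η k) := by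
  classical
  rw [upperPart, if_pos hN]
  change ∑ e : Fin N → Fin N, coef ν σ e η * ∏ k, gauss σ (η (e k)) (ξ k) = _
  rw [Finset.sum_eq_single id (fun e _ he => ?_) (fun h => absurd (Finset.mem_univ _) h)]
  · rw [Finset.prod_mul_distrib]
    congr 1
    · by_cases hup : ∀ k, σ ≤ (η k).2 - (η k).1
      · have h0 : numLower σ η = 0 := by
          rw [numLower]
          exact Fintype.card_eq_zero_iff.2 ⟨fun i => not_lt.2 (hup i) i.2⟩
        rw [coef, if_pos ⟨strictMono_id, hη, hup⟩, h0, lowerCardinality_zero hν]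
        simp [cutAmplitude, hup]
      · obtain ⟨k, hk⟩ := not_forall.1 hup
        rw [coef, if_neg fun h => hup h.2.2, Finset.prod_eq_zero (Finset.mem_univ k)]
        rw [cutAmplitude, if_neg hk]
    · exact Finset.prod_congr rfl fun k _ => gauss_comm _ _ _
  · rw [coef, if_neg fun h => he ((strictMono_fin_iff e).1 h.1), zero_mul]

theorem isOpen_power {A : Set Feature} (hA : IsOpen A) (N : ℕ) : IsOpen (power A N) := by
  have h : power A N = Set.pi Set.univ fun _ => A := by ext; simp [power]
  rw [h]
  exact isOpen_set_pi Set.finite_univ fun _ _ => hA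

theorem prod_inv_one_add_sq_le_one {m : ℕ} (η : Fin m → Feature) :
    ∏ i, (1 + (η i).1 ^ 2)⁻¹ ≤ 1 :=
  Finset.prod_le_one (fun _ _ => by positivity) fun _ _ =>
    inv_le_one_of_one_le₀ (le_add_of_nonneg_right (sq_nonneg _))

/-- The local density `f N`, weighted with the amplitudes of the kernel and cut off outside the
wedge. -/
def weightedDensity (f : (N : ℕ) → (Fin N → Feature) → ℝ) (N : ℕ) (σ : ℝ) :
    (Fin N → Feature) → ℝ :=
  (power wedge N).indicator fun η => f N η * ∏ k, cutAmplitude σ (η k)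

theorem aemeasurable_weightedDensity {f : (N : ℕ) → (Fin N → Feature) → ℝ} (hf : IsGlobalPdf f)
    (N : ℕ) (σ : ℝ) : AEMeasurable (weightedDensity f N σ) :=
  (aemeasurable_indicator_iff (measurableSet_power measurableSet_wedge N)).2
    ((hf.aemeasurable N).mul (Finset.measurable_prod _ fun k _ =>
      (measurable_cutAmplitude σ).comp (measurable_pi_apply k)).aemeasurable)

theorem abs_weightedDensity_le {f : (N : ℕ) → (Fin N → Feature) → ℝ} (hf : IsGlobalPdf f)
    {N : ℕ} {σ : ℝ} (hσ : 0 < σ) {C : ℝ} (hC : 0 ≤ C)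
    (hfC : ∀ η ∈ power wedge N, f N η ≤ C * ∏ i, (1 + (η i).1 ^ 2)⁻¹) (η : Fin N → Feature) :
    |weightedDensity f N σ η| ≤ C * (1 / massBound) ^ N := by
  have hb := massBound_pos
  by_cases hη : η ∈ power wedge N
  · rw [weightedDensity, Set.indicator_of_mem hη, abs_of_nonneg (mul_nonneg (hf.nonneg N η hη)
      (Finset.prod_nonneg fun _ _ => cutAmplitude_nonneg _ _))]
    refine mul_le_mul ((hfC η hη).trans (mul_le_of_le_one_right hC (prod_inv_one_add_sq_le_one η)))
      ?_ (Finset.prod_nonneg fun _ _ => cutAmplitude_nonneg _ _) hC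
    exact (Finset.prod_le_prod (fun _ _ => cutAmplitude_nonneg _ _)
      fun k _ => cutAmplitude_le hσ (hη k)).trans (by simp)
  · rw [weightedDensity, Set.indicator_of_notMem hη, abs_zero]
    positivity

theorem integrable_prod_gauss {σ : ℝ} (hσ : 0 < σ) {N : ℕ} (ξ : Fin N → Feature) :
    Integrable fun η : Fin N → Feature => ∏ k, gauss σ (ξ k) (η k) :=
  Integrable.fintype_prod fun k => integrable_gauss hσ (ξ k)

theorem integral_prod_gauss {σ : ℝ} (hσ : 0 < σ) {N : ℕ} (ξ : Fin N → Feature) :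
    ∫ η : Fin N → Feature, ∏ k, gauss σ (ξ k) (η k) = 1 := by
  rw [integral_fintype_prod_volume_eq_prod]
  simp [integral_gauss hσ]

theorem rescaled_weightedDensity {N : ℕ} (F : (Fin N → Feature) → ℝ) {σ : ℝ} (hσ : 0 < σ)
    (ξ u : Fin N → Feature) :
    σ ^ Module.finrank ℝ (Fin N → Feature) * (F (ξ + σ • u) *
      ∏ k, gauss σ (ξ k) ((ξ + σ • u) k)) = F (ξ + σ • u) * ∏ k, gauss 1 0 (u k) := by
  have hfin : Module.finrank ℝ (Fin N → Feature) = 2 * N := by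
    rw [Module.finrank_pi_fintype]
    simp [Feature, mul_comm]
  have h : ∏ k, gauss 1 0 (u k) = σ ^ (2 * N) * ∏ k, gauss σ (ξ k) ((ξ + σ • u) k) := by
    rw [pow_mul]
    calc ∏ k, gauss 1 0 (u k) = ∏ k, σ ^ 2 * gauss σ (ξ k) ((ξ + σ • u) k) :=
          Finset.prod_congr rfl fun k _ => (gauss_add_smul hσ (ξ k) (u k)).symm
      _ = _ := by rw [Finset.prod_mul_distrib]; simp
  rw [hfin, h]
  ring

/-- After the substitution η = ξ + σu the Gaussian weight depends on neither σ nor ξ and can serve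
as a dominating function. -/
theorem layerMean_self {f : (N : ℕ) → (Fin N → Feature) → ℝ} {ν : ℕ → PMF ℕ}
    (hν : IsLowerCardinality ν) {M N : ℕ} (hN : N ≤ M) {σ : ℝ} (hσ : 0 < σ) (ξ : Fin N → Feature) :
    layerMean f ν M N σ ξ =
      ∫ u, weightedDensity f N σ (ξ + σ • u) * ∏ k, gauss 1 0 (u k) := by
  have hW := measurableSet_power measurableSet_wedge N
  have h1 : layerMean f ν M N σ ξ =
      ∫ η, weightedDensity f N σ η * ∏ k, gauss σ (ξ k) (η k) := by
    rw [layerMean, ← integral_indicator hW]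
    refine integral_congr_ae (ae_of_all _ fun η => ?_)
    by_cases hη : η ∈ power wedge N
    · simp only [weightedDensity, Set.indicator_of_mem hη]
      rw [upperPart_self hν hN σ ξ hη, Finset.prod_mul_distrib, mul_assoc]
    · simp only [weightedDensity, Set.indicator_of_notMem hη, zero_mul]
  rw [h1, integral_eq_integral_add_smul volume
    (fun η => weightedDensity f N σ η * ∏ k, gauss σ (ξ k) (η k)) ξ hσ]
  exact integral_congr_ae (ae_of_all _ fun u => rescaled_weightedDensity _ hσ ξ u)

/-- Since f N is only almost everywhere measurable, composition with u ↦ ξ + σu is justified through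
integrability, which translations and dilations preserve. -/
theorem aestronglyMeasurable_rescaled {f : (N : ℕ) → (Fin N → Feature) → ℝ} (hf : IsGlobalPdf f)
    {N : ℕ} {σ : ℝ} (hσ : 0 < σ) {C : ℝ} (hC : 0 ≤ C)
    (hfC : ∀ η ∈ power wedge N, f N η ≤ C * ∏ i, (1 + (η i).1 ^ 2)⁻¹) (ξ : Fin N → Feature) :
    AEStronglyMeasurable
      fun u => weightedDensity f N σ (ξ + σ • u) * ∏ k, gauss 1 0 (u k) := by
  have h1 : Integrable fun η => weightedDensity f N σ η * ∏ k, gauss σ (ξ k) (η k) := by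
    refine ((integrable_prod_gauss hσ ξ).const_mul (C * (1 / massBound) ^ N)).mono'
      ((aemeasurable_weightedDensity hf N σ).aestronglyMeasurable.mul
        (integrable_prod_gauss hσ ξ).aestronglyMeasurable) (ae_of_all _ fun η => ?_)
    have h0 : 0 ≤ ∏ k, gauss σ (ξ k) (η k) := Finset.prod_nonneg fun _ _ => gauss_nonneg _ _ _
    rw [Real.norm_eq_abs, abs_mul, abs_of_nonneg h0]
    exact mul_le_mul_of_nonneg_right (abs_weightedDensity_le hf hσ hC hfC η) h0
  have h2 := (((h1.comp_add_left ξ).comp_smul hσ.ne').const_mul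
    (σ ^ Module.finrank ℝ (Fin N → Feature))).aestronglyMeasurable
  exact h2.congr (ae_of_all _ fun u => rescaled_weightedDensity _ hσ ξ u)

theorem tendsto_weightedDensity {f : (N : ℕ) → (Fin N → Feature) → ℝ} {N : ℕ}
    (hcont : ContinuousOn (f N) (power openWedge N)) {ξ₀ : Fin N → Feature}
    (hξ₀ : ξ₀ ∈ power openWedge N) (u : Fin N → Feature) :
    Tendsto (fun p : ℝ × (Fin N → Feature) => weightedDensity f N p.1 (p.2 + p.1 • u))
      (𝓝[>] 0 ×ˢ 𝓝 ξ₀) (𝓝 (f N ξ₀)) := by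
  have hnhds : power openWedge N ∈ 𝓝 ξ₀ := (isOpen_power isOpen_openWedge N).mem_nhds hξ₀
  have h1 : Tendsto (fun p : ℝ × (Fin N → Feature) => f N (p.2 + p.1 • u))
      (𝓝[>] 0 ×ˢ 𝓝 ξ₀) (𝓝 (f N ξ₀)) :=
    (hcont.continuousAt hnhds).tendsto.comp (tendsto_add_smul ξ₀ u)
  have h2 : Tendsto (fun p : ℝ × (Fin N → Feature) => ∏ k, cutAmplitude p.1 ((p.2 + p.1 • u) k))
      (𝓝[>] 0 ×ˢ 𝓝 ξ₀) (𝓝 (∏ _k : Fin N, 1)) := by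
    refine tendsto_finsetProd _ fun k _ => ?_
    exact (tendsto_cutAmplitude (hξ₀ k)).comp (tendsto_fst.prodMk
      (((continuous_apply k).tendsto ξ₀).comp (tendsto_add_smul ξ₀ u)))
  have h3 := h1.mul h2
  rw [Finset.prod_const_one, mul_one] at h3
  refine h3.congr' ?_
  filter_upwards [(tendsto_add_smul ξ₀ u).eventually hnhds] with p hp
  have hp' : p.2 + p.1 • u ∈ power wedge N := fun k => openWedge_subset_wedge (hp k)
  rw [weightedDensity, Set.indicator_of_mem hp']

theorem tendsto_layerMean_self {f : (N : ℕ) → (Fin N → Feature) → ℝ} (hf : IsGlobalPdf f)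
    {ν : ℕ → PMF ℕ} (hν : IsLowerCardinality ν) {M N : ℕ} (hN : N ≤ M)
    (hcont : ContinuousOn (f N) (power openWedge N)) {C : ℝ} (hC : 0 ≤ C)
    (hfC : ∀ η ∈ power wedge N, f N η ≤ C * ∏ i, (1 + (η i).1 ^ 2)⁻¹)
    {ξ₀ : Fin N → Feature} (hξ₀ : ξ₀ ∈ power openWedge N) :
    Tendsto (fun p : ℝ × (Fin N → Feature) => layerMean f ν M N p.1 p.2)
      (𝓝[>] 0 ×ˢ 𝓝 ξ₀) (𝓝 (f N ξ₀)) := by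
  have hpos : ∀ᶠ p : ℝ × (Fin N → Feature) in 𝓝[>] 0 ×ˢ 𝓝 ξ₀, 0 < p.1 :=
    (eventually_mem_nhdsWithin).prod_inl _
  have hlim : ∫ u : Fin N → Feature, f N ξ₀ * ∏ k, gauss 1 0 (u k) = f N ξ₀ := by
    rw [integral_const_mul]
    have := integral_prod_gauss one_pos (fun _ : Fin N => (0 : Feature))
    rw [this, mul_one]
  rw [← hlim]
  have heq : (fun p : ℝ × (Fin N → Feature) =>
      ∫ u, weightedDensity f N p.1 (p.2 + p.1 • u) * ∏ k, gauss 1 0 (u k)) =ᶠ[𝓝[>] 0 ×ˢ 𝓝 ξ₀]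
      fun p => layerMean f ν M N p.1 p.2 := by
    filter_upwards [hpos] with p hp using (layerMean_self hν hN hp p.2).symm
  refine Tendsto.congr' heq ?_
  refine tendsto_integral_filter_of_dominated_convergence
    (fun u => C * (1 / massBound) ^ N * ∏ k, gauss 1 0 (u k)) ?_ ?_
    ((integrable_prod_gauss one_pos fun _ => 0).const_mul _) ?_
  · filter_upwards [hpos] with p hp using aestronglyMeasurable_rescaled hf hp hC hfC p.2
  · filter_upwards [hpos] with p hp
    refine ae_of_all _ fun u => ?_
    have h0 : 0 ≤ ∏ k, gauss 1 0 (u k) := Finset.prod_nonneg fun _ _ => gauss_nonneg _ _ _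
    rw [Real.norm_eq_abs, abs_mul, abs_of_nonneg h0]
    exact mul_le_mul_of_nonneg_right (abs_weightedDensity_le hf hp hC hfC _) h0
  · exact ae_of_all _ fun u => (tendsto_weightedDensity hcont hξ₀ u).mul_const _

theorem tendsto_layerMean_of_lt {f : (N : ℕ) → (Fin N → Feature) → ℝ} (hf : IsGlobalPdf f)
    (ν : ℕ → PMF ℕ) {M m N : ℕ} (hm : m ≤ M) (hN : N < m) {C : ℝ} (hC : 0 ≤ C)
    (hfC : ∀ η ∈ power wedge m, f m η ≤ C * ∏ i, (1 + (η i).1 ^ 2)⁻¹) (ξ₀ : Fin N → Feature) :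
    Tendsto (fun p : ℝ × (Fin N → Feature) => layerMean f ν M m p.1 p.2)
      (𝓝[>] 0 ×ˢ 𝓝 ξ₀) (𝓝 0) := by
  have hpos : ∀ᶠ p : ℝ × (Fin N → Feature) in 𝓝[>] 0 ×ˢ 𝓝 ξ₀, 0 < p.1 :=
    (eventually_mem_nhdsWithin).prod_inl _
  have h1 : Tendsto (fun σ : ℝ => C * (1 / massBound) ^ N *
      (((M : ℝ) + 1) ^ N * (32 * Real.pi ^ 2 * σ) ^ (m - N))) (𝓝 0) (𝓝 0) := by
    have hc : Continuous fun σ : ℝ => C * (1 / massBound) ^ N *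
      (((M : ℝ) + 1) ^ N * (32 * Real.pi ^ 2 * σ) ^ (m - N)) := by fun_prop
    have := hc.tendsto 0
    rwa [mul_zero, zero_pow (Nat.sub_ne_zero_of_lt hN), mul_zero, mul_zero] at this
  refine tendsto_of_tendsto_of_tendsto_of_le_of_le' tendsto_const_nhds
    ((h1.mono_left nhdsWithin_le_nhds).comp tendsto_fst) ?_ ?_
  · filter_upwards [hpos] with p hp using layerMean_nonneg hf ν M m hp p.2
  · filter_upwards [hpos] with p hp using layerMean_le hf ν hm hp p.2 hC hfC

/-! ### The expectation of the kernel -/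

/-- The expectation of `upperPart`. -/
def mean (f : (N : ℕ) → (Fin N → Feature) → ℝ) (ν : ℕ → PMF ℕ) (M : ℕ) (σ : ℝ) {N : ℕ}
    (ξ : Fin N → Feature) : ℝ := ∫ D, upperPart ν M σ ξ D ∂diagramLaw f

theorem mean_eq_sum {f : (N : ℕ) → (Fin N → Feature) → ℝ} (hf : IsGlobalPdf f)
    [IsProbabilityMeasure (diagramLaw f)] (ν : ℕ → PMF ℕ) (M : ℕ) {σ : ℝ} (hσ : 0 < σ) {N : ℕ}
    (ξ : Fin N → Feature) :
    mean f ν M σ ξ = ∑ m ∈ Finset.range (M + 1), layerMean f ν M m σ ξ := by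
  refine integral_diagramLaw hf (measurable_upperPart ν M σ ξ) (integrable_of_bounded
    (measurable_upperPart ν M σ ξ) (upperPart_nonneg ν M hσ ξ) (upperPart_le ν M hσ ξ))
    fun m hm η => ?_
  rw [upperPart, if_neg (not_le.2 hm)]

/-- Provides the constant that bounds the means, and with them the second moments, in the
exponential inequality. -/
theorem exists_mean_le {f : (N : ℕ) → (Fin N → Feature) → ℝ} (hf : IsGlobalPdf f) {M : ℕ}
    [IsProbabilityMeasure (diagramLaw f)]
    (hA2 : BoundedLocalDensities f M) (hA3 : PolynomialDecay f M) (ν : ℕ → PMF ℕ) (N : ℕ) :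
    ∃ C : ℝ, 0 < C ∧ ∀ σ : ℝ, 0 < σ → σ ≤ 1 → ∀ ξ : Fin N → Feature, mean f ν M σ ξ ≤ C := by
  have hb := massBound_pos
  choose! C hC hfC using fun m (hm : m ≤ M) => exists_le_mul_prod hA2 hA3 hm
  refine ⟨∑ m ∈ Finset.range (M + 1), C m * (1 / massBound) ^ N *
      (((M : ℝ) + 1) ^ N * (32 * Real.pi ^ 2 * 1) ^ (m - N)), ?_, fun σ hσ hσ1 ξ => ?_⟩
  · refine Finset.sum_pos (fun m hm => ?_) ⟨0, by simp⟩
    have := hC m (by simpa [Nat.lt_succ_iff] using hm)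
    positivity
  · rw [mean_eq_sum hf ν M hσ]
    refine Finset.sum_le_sum fun m hm => ?_
    have hm' : m ≤ M := by simpa [Nat.lt_succ_iff] using hm
    have := hC m hm'
    refine (layerMean_le hf ν hm' hσ ξ this.le (hfC m hm')).trans ?_
    gcongr

theorem tendsto_mean {f : (N : ℕ) → (Fin N → Feature) → ℝ} (hf : IsGlobalPdf f) {M N : ℕ}
    [IsProbabilityMeasure (diagramLaw f)] (hN : N ≤ M)
    (hcont : ContinuousOn (f N) (power openWedge N))
    (hA2 : BoundedLocalDensities f M) (hA3 : PolynomialDecay f M) {ν : ℕ → PMF ℕ}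
    (hν : IsLowerCardinality ν) {ξ₀ : Fin N → Feature} (hξ₀ : ξ₀ ∈ power openWedge N) :
    Tendsto (fun p : ℝ × (Fin N → Feature) => mean f ν M p.1 p.2)
      (𝓝[>] 0 ×ˢ 𝓝 ξ₀) (𝓝 (f N ξ₀)) := by
  have hpos : ∀ᶠ p : ℝ × (Fin N → Feature) in 𝓝[>] 0 ×ˢ 𝓝 ξ₀, 0 < p.1 :=
    (eventually_mem_nhdsWithin).prod_inl _
  have h1 : ∀ m ∈ Finset.range (M + 1), Tendsto (fun p : ℝ × (Fin N → Feature) =>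
      layerMean f ν M m p.1 p.2) (𝓝[>] 0 ×ˢ 𝓝 ξ₀) (𝓝 (if m = N then f N ξ₀ else 0)) := fun m hm => by
    have hm' : m ≤ M := by simpa [Nat.lt_succ_iff] using hm
    obtain ⟨C, hC, hfC⟩ := exists_le_mul_prod hA2 hA3 hm'
    rcases lt_trichotomy m N with h | rfl | h
    · rw [if_neg h.ne]
      refine tendsto_const_nhds.congr fun p => ?_
      simp [layerMean, fun η : Fin m → Feature => upperPart_eq_zero_of_lt ν M p.1 p.2 ⟨m, η⟩ h]
    · rw [if_pos rfl]
      exact tendsto_layerMean_self hf hν hN hcont hC.le hfC hξ₀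
    · rw [if_neg h.ne']
      exact tendsto_layerMean_of_lt hf ν hm' h hC.le hfC ξ₀
  have h2 := tendsto_finsetSum _ h1
  rw [Finset.sum_ite_eq' (Finset.range (M + 1)) N, if_pos (by simpa [Nat.lt_succ_iff] using hN)]
    at h2
  refine h2.congr' ?_
  filter_upwards [hpos] with p hp using (mean_eq_sum hf ν M hp p.2).symm

/-- Joint convergence in (σ, ξ) together with continuity of the limit is local uniform convergence,
and K is compact. -/
theorem tendstoUniformlyOn_mean {f : (N : ℕ) → (Fin N → Feature) → ℝ} (hf : IsGlobalPdf f)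
    {M N : ℕ} [IsProbabilityMeasure (diagramLaw f)] (hN : N ≤ M)
    (hcont : ContinuousOn (f N) (power openWedge N))
    (hA2 : BoundedLocalDensities f M) (hA3 : PolynomialDecay f M) {ν : ℕ → PMF ℕ}
    (hν : IsLowerCardinality ν) {K : Set (Fin N → Feature)} (hK : IsCompact K)
    (hKW : K ⊆ power openWedge N) :
    TendstoUniformlyOn (fun σ ξ => mean f ν M σ ξ) (f N) (𝓝[>] 0) K := by
  refine (tendstoLocallyUniformlyOn_iff_tendstoUniformlyOn_of_compact hK).1
    (tendstoLocallyUniformlyOn_iff_forall_tendsto.2 fun ξ₀ hξ₀ => ?_)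
  have h1 := (tendsto_mean hf hN hcont hA2 hA3 hν (hKW hξ₀)).mono_left
    (Filter.prod_mono_right (𝓝[>] (0 : ℝ)) (nhdsWithin_le_nhds (s := K)))
  have h2 : Tendsto (fun p : ℝ × (Fin N → Feature) => f N p.2) (𝓝[>] 0 ×ˢ 𝓝[K] ξ₀)
      (𝓝 (f N ξ₀)) := ((hcont.mono hKW) ξ₀ hξ₀).tendsto.comp tendsto_snd
  exact (h2.prodMk_nhds h1).mono_right (nhds_le_uniformity _)

/-! ### Bandwidths -/

theorem tendsto_bandwidth {σ : ℕ → ℝ} (hσpos : ∀ n, 0 < σ n) {α : ℝ} (hα : 0 < α)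
    (hσ : σ =Θ[atTop] fun n : ℕ => (n : ℝ) ^ (-α)) : Tendsto σ atTop (𝓝[>] 0) := by
  refine tendsto_nhdsWithin_iff.2 ⟨?_, Eventually.of_forall hσpos⟩
  exact hσ.1.trans_tendsto ((tendsto_rpow_neg_atTop hα).comp tendsto_natCast_atTop_atTop)

theorem exists_bandwidth_ge {σ : ℕ → ℝ} (hσpos : ∀ n, 0 < σ n) {α : ℝ}
    (hσ : σ =Θ[atTop] fun n : ℕ => (n : ℝ) ^ (-α)) :
    ∃ c : ℝ, 0 < c ∧ ∀ᶠ n : ℕ in atTop, c * (n : ℝ) ^ (-α) ≤ σ n := by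
  obtain ⟨c, hc, h⟩ := hσ.2.exists_pos
  refine ⟨c⁻¹, inv_pos.2 hc, ?_⟩
  filter_upwards [h.bound] with n hn
  rw [Real.norm_of_nonneg (by positivity), Real.norm_of_nonneg (hσpos n).le] at hn
  rwa [inv_mul_le_iff₀ hc]

/-- The exponent of the tail bound: n/B with B of order σ^(-2N). The threshold on α comes from
requiring 1 - 2Nα > 0. -/
theorem eventually_rpow_le_div_pow {σ : ℕ → ℝ} (hσpos : ∀ n, 0 < σ n) {α c A : ℝ} (hc : 0 < c)
    (hσc : ∀ᶠ n : ℕ in atTop, c * (n : ℝ) ^ (-α) ≤ σ n) (hA : 0 < A) (N : ℕ) :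
    ∀ᶠ n : ℕ in atTop, (c ^ 2 / A) ^ N * (n : ℝ) ^ (1 - α * (2 * N)) ≤
      n / (A * (1 / σ n ^ 2)) ^ N := by
  filter_upwards [hσc, eventually_gt_atTop 0] with n h hn
  have hn' : (0 : ℝ) < n := Nat.cast_pos.2 hn
  have hs := hσpos n
  have e1 : (n : ℝ) / (A * (1 / σ n ^ 2)) ^ N = n * (σ n ^ 2 / A) ^ N := by
    rw [div_eq_mul_inv, ← inv_pow]; congr 2; field_simp
  have e2 : (n : ℝ) ^ (1 - α * (2 * N)) = n * (((n : ℝ) ^ (-α)) ^ 2) ^ N := by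
    rw [← pow_mul, ← Real.rpow_mul_natCast hn'.le, sub_eq_add_neg, Real.rpow_add hn', Real.rpow_one]
    congr 2
    push_cast
    ring
  rw [e1, e2, mul_left_comm, ← mul_pow]
  refine mul_le_mul_of_nonneg_left (pow_le_pow_left₀ (by positivity) ?_ N) hn'.le
  rw [div_mul_eq_mul_div, ← mul_pow]
  gcongr

theorem exists_tendsto_div_pow {σ : ℕ → ℝ} (hσpos : ∀ n, 0 < σ n) {α c A : ℝ} (hc : 0 < c)
    (hσc : ∀ᶠ n : ℕ in atTop, c * (n : ℝ) ^ (-α) ≤ σ n) (hA : 0 < A) (N : ℕ) :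
    ∃ p : ℕ, Tendsto (fun n : ℕ => (A * (1 / σ n ^ 2)) ^ N * (2 * N / σ n) / (n : ℝ) ^ p) atTop
      (𝓝 0) := by
  -- The Lipschitz constant has order σ^(-2N-1), which is O(n^(α(2N+1))).
  obtain ⟨p, hp⟩ := exists_nat_gt (α * (2 * N + 1))
  refine ⟨p, ?_⟩
  have h1 : Tendsto (fun n : ℕ => (A * (1 / c ^ 2)) ^ N * (2 * N / c) *
      (n : ℝ) ^ (-((p : ℝ) - α * (2 * N + 1)))) atTop (𝓝 0) := by
    have := ((tendsto_rpow_neg_atTop (sub_pos.2 hp)).comp tendsto_natCast_atTop_atTop).const_mul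
      ((A * (1 / c ^ 2)) ^ N * (2 * N / c))
    rwa [mul_zero] at this
  refine squeeze_zero' (Eventually.of_forall fun n => ?_) ?_ h1
  · have := hσpos n
    positivity
  filter_upwards [hσc, eventually_gt_atTop 0] with n h hn
  have hn' : (0 : ℝ) < n := Nat.cast_pos.2 hn
  have hs := hσpos n
  set x := (n : ℝ) ^ (-α) with hx
  have hx0 : 0 < x := by positivity
  have e : (n : ℝ) ^ (-((p : ℝ) - α * (2 * N + 1))) = ((1 / x ^ 2) ^ N * (1 / x)) / (n : ℝ) ^ p := by
    have e1 : -((p : ℝ) - α * (2 * N + 1)) = -(-α * ((2 * N + 1 : ℕ) : ℝ)) - p := by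
      push_cast; ring
    rw [e1, Real.rpow_sub hn', Real.rpow_natCast, Real.rpow_neg hn'.le,
      Real.rpow_mul_natCast hn'.le, ← hx, pow_succ, pow_mul, one_div, one_div, mul_inv, inv_pow]
  rw [e]
  calc (A * (1 / σ n ^ 2)) ^ N * (2 * N / σ n) / (n : ℝ) ^ p ≤
      (A * (1 / (c * x) ^ 2)) ^ N * (2 * N / (c * x)) / (n : ℝ) ^ p := by gcongr
    _ = _ := by
      rw [mul_pow c x, ← one_div_mul_one_div, ← mul_assoc A, mul_pow _ (1 / x ^ 2)]
      field_simp

/-! ### Random centers -/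

theorem ae_diagramLaw {f : (N : ℕ) → (Fin N → Feature) → ℝ} (hf : IsGlobalPdf f) {M : ℕ}
    (hA1 : BoundedCardinality f M) :
    ∀ᵐ Z ∂diagramLaw f, Z.1 ≤ M ∧ Z.2 ∈ power wedge Z.1 := by
  have hms : MeasurableSet {Z : Diagram | Z.1 ≤ M ∧ Z.2 ∈ power wedge Z.1} :=
    MeasurableSpace.measurableSet_iInf.2 fun m =>
      (MeasurableSet.const (m ≤ M)).inter (measurableSet_power measurableSet_wedge m)
  refine Measure.ae_sum_iff.2 fun m => ?_
  rw [ae_map_iff (measurable_sigmaMk m).aemeasurable hms,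
    ae_withDensity_iff' (hf.aemeasurable m).ennreal_ofReal]
  filter_upwards [ae_restrict_mem (measurableSet_power measurableSet_wedge m)] with ξ hξ h
  refine ⟨?_, hξ⟩
  by_contra hm
  exact h (by rw [hA1 m (not_le.1 hm) ξ hξ, ENNReal.ofReal_zero])

section Random

variable {Ω : Type*} [MeasurableSpace Ω] {P : Measure Ω} [IsProbabilityMeasure P]

theorem ae_eventually_abs_avg_upperPart_sub_lt {M : ℕ} {f : (N : ℕ) → (Fin N → Feature) → ℝ}
    (hf : IsGlobalPdf f) (hA2 : BoundedLocalDensities f M) (hA3 : PolynomialDecay f M)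
    (ν : ℕ → PMF ℕ) {D : ℕ → Ω → Diagram} (hDmeas : ∀ i, Measurable (D i))
    (hDindep : iIndepFun D P) (hDlaw : ∀ i, P.map (D i) = diagramLaw f)
    {α : ℝ} (hα0 : 0 < α) (hα : α * (2 * (M : ℝ)) < 1)
    {σ : ℕ → ℝ} (hσpos : ∀ n, 0 < σ n) (hσ : σ =Θ[atTop] fun n : ℕ => (n : ℝ) ^ (-α))
    {N : ℕ} (hN : N ≤ M) (R : ℕ) {ε : ℝ} (hε : 0 < ε) :
    ∀ᵐ ω ∂P, ∀ᶠ n : ℕ in atTop, ∀ ξ : Fin N → Feature,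
      (∀ k, ξ k ∈ Set.Icc (0 : ℝ) R ×ˢ Set.Icc (0 : ℝ) R) →
      |1 / (n : ℝ) * ∑ i ∈ Finset.range n, upperPart ν M (σ n) ξ (D i ω) - mean f ν M (σ n) ξ| <
        ε := by
  have hb := massBound_pos
  have : IsProbabilityMeasure (diagramLaw f) := by
    rw [← hDlaw 0]; exact Measure.isProbabilityMeasure_map (hDmeas 0).aemeasurable
  obtain ⟨C, hC, hmean⟩ := exists_mean_le hf hA2 hA3 ν N
  obtain ⟨c, hc, hσc⟩ := exists_bandwidth_ge hσpos hσ
  set A : ℝ := ((M : ℝ) + 1) * (1 / massBound) * (1 / (2 * Real.pi)) with hA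
  have hA0 : 0 < A := by positivity
  have hAσ : ∀ s : ℝ, ((M : ℝ) + 1) * (1 / massBound) * (1 / (2 * Real.pi * s ^ 2)) =
      A * (1 / s ^ 2) := fun s => by
    rw [hA, mul_assoc _ (1 / (2 * Real.pi)), one_div_mul_one_div]
  obtain ⟨p, hp⟩ := exists_tendsto_div_pow hσpos hc hσc hA0 N
  have hβ : 0 < 1 - α * (2 * (N : ℝ)) := by
    have : (N : ℝ) ≤ M := Nat.cast_le.2 hN
    nlinarith
  refine ae_eventually_abs_avg_sub_lt hDmeas hDindep (g := fun n ξ => upperPart ν M (σ n) ξ)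
    (B := fun n => (A * (1 / σ n ^ 2)) ^ N) (L := fun n => (A * (1 / σ n ^ 2)) ^ N * (2 * N / σ n))
    (fun n ξ => measurable_upperPart ν M (σ n) ξ) (fun n ξ d => upperPart_nonneg ν M (hσpos n) ξ d)
    (fun n ξ d => ?_) (fun n ξ ξ' d => ?_) (fun n ξ i => ?_) hC ?_
    (by positivity : 0 < (c ^ 2 / A) ^ N) hβ (fun n => ?_) (fun n => ?_)
    (eventually_rpow_le_div_pow hσpos hc hσc hA0 N) hp R hε
  · rw [← hAσ]; exact upperPart_le ν M (hσpos n) ξ d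
  · rw [← hAσ]; exact abs_upperPart_sub_le ν M (hσpos n) ξ ξ' d
  · rw [mean, ← hDlaw i, integral_map (hDmeas i).aemeasurable
      (measurable_upperPart ν M (σ n) ξ).aestronglyMeasurable]
  · have h1 := (tendsto_bandwidth hσpos hα0 hσ).mono_right nhdsWithin_le_nhds
    filter_upwards [h1.eventually (gt_mem_nhds one_pos)] with n hn ξ
    exact hmean _ (hσpos n) hn.le ξ
  · have := hσpos n
    positivity
  · have := hσpos n
    positivity

end Random

/-! ### Compact sets of diagrams -/

/-- The gaps form a compact set of positive reals, possibly empty when N = 0. -/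
theorem exists_gap_le {N : ℕ} {K : Set (Fin N → Feature)} (hK : IsCompact K)
    (hKW : K ⊆ power openWedge N) :
    ∃ δ : ℝ, 0 < δ ∧ ∀ ξ ∈ K, ∀ k, δ ≤ (ξ k).2 - (ξ k).1 := by
  have hc : IsCompact (⋃ k : Fin N, (fun ξ : Fin N → Feature => (ξ k).2 - (ξ k).1) '' K) :=
    isCompact_iUnion fun k => hK.image (by fun_prop)
  obtain ⟨δ, hδ, h⟩ := hc.exists_forall_le' (f := fun t : ℝ => t) continuousOn_id (a := 0)
    fun t ht => by
      obtain ⟨k, ξ, hξ, rfl⟩ := Set.mem_iUnion.1 ht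
      exact sub_pos.2 (hKW hξ k).2
  exact ⟨δ, hδ, fun ξ hξ k => h _ (Set.mem_iUnion.2 ⟨k, ξ, hξ, rfl⟩)⟩

theorem exists_mem_Icc {N : ℕ} {K : Set (Fin N → Feature)} (hK : IsCompact K)
    (hKW : K ⊆ power openWedge N) :
    ∃ R : ℕ, ∀ ξ ∈ K, ∀ k, ξ k ∈ Set.Icc (0 : ℝ) R ×ˢ Set.Icc (0 : ℝ) R := by
  obtain ⟨r, hr⟩ := hK.isBounded.exists_norm_le
  refine ⟨⌈r⌉₊, fun ξ hξ k => ?_⟩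
  have h1 : ‖ξ k‖ ≤ ⌈r⌉₊ := ((norm_le_pi_norm ξ k).trans (hr ξ hξ)).trans (Nat.le_ceil r)
  have h2 := hKW hξ k
  exact ⟨⟨h2.1.le, (le_abs_self _).trans ((norm_fst_le _).trans h1)⟩,
    ⟨(h2.1.trans h2.2).le, (le_abs_self _).trans ((norm_snd_le _).trans h1)⟩⟩

/-- The length is continuous into ℕ, so a compact set meets only finitely many layers. -/
theorem tendstoUniformlyOn_diagram {F : ℕ → Diagram → ℝ} {g : Diagram → ℝ} {K : Set Diagram}
    (hK : IsCompact K) (h : ∀ N, ∀ ε > 0, ∀ᶠ n in atTop, ∀ ξ ∈ Sigma.mk N ⁻¹' K,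
      |F n ⟨N, ξ⟩ - g ⟨N, ξ⟩| < ε) : TendstoUniformlyOn F g atTop K := by
  have hfst : Continuous (Sigma.fst : Diagram → ℕ) :=
    continuous_sigma fun _ => continuous_const
  obtain ⟨B, hB⟩ := (hK.image hfst).bddAbove
  refine Metric.tendstoUniformlyOn_iff.2 fun ε hε => ?_
  filter_upwards [(Filter.eventually_all_finset (Finset.range (B + 1))).2 fun N _ => h N ε hε]
    with n hn Z hZ
  rw [dist_comm, Real.dist_eq]
  exact hn Z.1 (Finset.mem_range.2 (Nat.lt_succ_of_le (hB ⟨Z, hZ, rfl⟩))) Z.2 hZ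

theorem abs_kde_sub_avg_le (ν : ℕ → PMF ℕ) {δ σ : ℝ} (hσ : 0 < σ) (hδ : 0 ≤ δ) {M N : ℕ}
    {ξ : Fin N → Feature} (hξW : ξ ∈ power wedge N) (hξ : ∀ k, δ ≤ (ξ k).2 - (ξ k).1)
    {D : ℕ → Diagram} (hD : ∀ i, (D i).1 ≤ M ∧ (D i).2 ∈ power wedge (D i).1) {n : ℕ}
    (hn : 0 < n) :
    |kde ν σ D n ⟨N, ξ⟩ - 1 / (n : ℝ) * ∑ i ∈ Finset.range n, upperPart ν M σ ξ (D i)| ≤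
      lowerError M N δ σ := by
  have hn' : (0 : ℝ) < n := Nat.cast_pos.2 hn
  rw [kde, ← mul_sub, ← Finset.sum_sub_distrib, abs_mul,
    abs_of_pos (by positivity : 0 < 1 / (n : ℝ)), one_div, inv_mul_le_iff₀ hn']
  refine (Finset.abs_sum_le_sum_abs _ _).trans ((Finset.sum_le_sum fun i _ =>
    abs_kernel_sub_upperPart_le ν hσ hδ hξW hξ (hD i).1 (hD i).2).trans ?_)
  simp

end PersistenceKDE

end

/-! ### Assembly of the convergence theorem -/

open PersistenceKDE in
theorem mainTheorem1
    (M : ℕ) (f : (N : ℕ) → (Fin N → Feature) → ℝ)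
    (hf : IsGlobalPdf f)
    (hcont : ∀ N, ContinuousOn (f N) (power openWedge N))
    (hA1 : BoundedCardinality f M)
    (hA2 : BoundedLocalDensities f M)
    (hA3 : PolynomialDecay f M)
    (ν : ℕ → PMF ℕ) (hν : IsLowerCardinality ν)
    {Ω : Type*} [MeasurableSpace Ω] (P : Measure Ω) [IsProbabilityMeasure P]
    (D : ℕ → Ω → Diagram)
    (hDmeas : ∀ i, Measurable (D i))
    (hDindep : iIndepFun D P)
    (hDlaw : ∀ i, P.map (D i) = diagramLaw f)
    (α : ℝ) (hα0 : 0 < α) (hα : α * (2 * (M : ℝ)) < 1)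
    (σ : ℕ → ℝ) (hσpos : ∀ n, 0 < σ n)
    (hσ : σ =Θ[atTop] fun n : ℕ => (n : ℝ) ^ (-α)) :
    ∀ᵐ ω ∂P, ∀ K : Set Diagram, IsCompact K → (∀ Z ∈ K, Z.2 ∈ power openWedge Z.1) →
      TendstoUniformlyOn (fun (n : ℕ) (Z : Diagram) => kde ν (σ n) (fun i => D i ω) n Z)
        (fun Z : Diagram => f Z.1 Z.2) atTop K := by
  have : IsProbabilityMeasure (diagramLaw f) := by
    rw [← hDlaw 0]; exact Measure.isProbabilityMeasure_map (hDmeas 0).aemeasurable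
  have hgood : ∀ᵐ ω ∂P, ∀ i, (D i ω).1 ≤ M ∧ (D i ω).2 ∈ power wedge (D i ω).1 :=
    ae_all_iff.2 fun i => ae_of_ae_map (hDmeas i).aemeasurable
      (by rw [hDlaw i]; exact ae_diagramLaw hf hA1)
  -- Boxes and tolerances range over countable families, so that one null set serves all compact
  -- sets and all ε.
  have hconc : ∀ᵐ ω ∂P, ∀ N ≤ M, ∀ R l : ℕ, ∀ᶠ n : ℕ in atTop, ∀ ξ : Fin N → Feature,
      (∀ k, ξ k ∈ Set.Icc (0 : ℝ) R ×ˢ Set.Icc (0 : ℝ) R) →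
      |1 / (n : ℝ) * ∑ i ∈ Finset.range n, upperPart ν M (σ n) ξ (D i ω) - mean f ν M (σ n) ξ| <
        1 / ((l : ℝ) + 1) :=
    ae_all_iff.2 fun N => ae_all_iff.2 fun hN => ae_all_iff.2 fun R => ae_all_iff.2 fun l =>
      ae_eventually_abs_avg_upperPart_sub_lt hf hA2 hA3 ν hDmeas hDindep hDlaw hα0 hα hσpos hσ hN R
        (by positivity)
  have hσ0 := tendsto_bandwidth hσpos hα0 hσ
  filter_upwards [hgood, hconc] with ω hD hc K hK hKW
  refine tendstoUniformlyOn_diagram hK fun N ε hε => ?_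
  set K' : Set (Fin N → Feature) := (@Sigma.mk ℕ (fun N => Fin N → Feature) N) ⁻¹' K with hK'
  have hK'c : IsCompact K' := Topology.IsClosedEmbedding.sigmaMk.isCompact_preimage hK
  have hK'W : K' ⊆ power openWedge N := fun ξ hξ => hKW ⟨N, ξ⟩ hξ
  have hK'W' : K' ⊆ power wedge N := fun ξ hξ k => openWedge_subset_wedge (hK'W hξ k)
  obtain ⟨δ, hδ, hgap⟩ := exists_gap_le hK'c hK'W
  have hlow : ∀ᶠ n in atTop, lowerError M N δ (σ n) < ε / 2 :=
    ((tendsto_lowerError M N hδ).comp hσ0).eventually (gt_mem_nhds (half_pos hε))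
  have hup : ∀ᶠ n : ℕ in atTop, ∀ ξ ∈ K',
      |1 / (n : ℝ) * ∑ i ∈ Finset.range n, upperPart ν M (σ n) ξ (D i ω) - f N ξ| < ε / 2 := by
    rcases le_or_gt N M with hN | hN
    · obtain ⟨R, hR⟩ := exists_mem_Icc hK'c hK'W
      obtain ⟨l, hl⟩ := exists_nat_one_div_lt (by positivity : 0 < ε / 4)
      have hmean := Metric.tendstoUniformlyOn_iff.1
        (tendstoUniformlyOn_mean hf hN (hcont N) hA2 hA3 hν hK'c hK'W) (ε / 4) (by positivity)
      filter_upwards [hc N hN R l, hσ0.eventually hmean] with n h1 h2 ξ hξ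
      have h3 := h1 ξ (hR ξ hξ)
      have h4 := h2 ξ hξ
      rw [Real.dist_eq, abs_sub_comm] at h4
      refine (abs_sub_le _ (mean f ν M (σ n) ξ) _).trans_lt ?_
      linarith
    -- No center has enough features to match an input longer than M, and f vanishes there by (A1).
    · refine Eventually.of_forall fun n ξ hξ => ?_
      rw [Finset.sum_eq_zero fun i _ =>
        upperPart_eq_zero_of_lt ν M (σ n) ξ (D i ω) ((hD i).1.trans_lt hN), hA1 N hN ξ (hK'W' hξ)]
      simpa using hε
  filter_upwards [hlow, hup, eventually_gt_atTop 0] with n h1 h2 hn ξ hξ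
  have h3 := abs_kde_sub_avg_le ν (hσpos n) hδ.le (hK'W' hξ) (hgap ξ hξ) hD hn
  have h4 := h2 ξ hξ
  refine (abs_sub_le _ (1 / (n : ℝ) * ∑ i ∈ Finset.range n, upperPart ν M (σ n) ξ (D i ω)) _).trans_lt
    ?_
  linarith
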